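/- Let $R$ be a commutative ring and $A,B,d\in R$. A weighted, marked graph $G$ is a finite graph, possibly with loops and with a number $\phi$ of free loops (components without vertices and edges), some of whose vertices are marked, with vertex weights $\alpha,\beta:V(G)\to R$. Let $\mathcal A(G)$ be its Boolean adjacency matrix over $GF(2)$ (with diagonal entry $1$ at looped vertices); for $T\subseteq V(G)$ let $\mathcal A(G)_T$ be obtained by changing the diagonal entries of the elements of $T$ and then removing the row and column of every marked vertex whose diagonal entry is $0$. With $\nu$ the $GF(2)$-nullity, $$[G]=d^{\phi}\sum_{T\subseteq V(G)}\Big(\prod_{v\notin T}\alpha(v)\Big)\Big(\prod_{t\in T}\beta(t)\Big)d^{\nu(\mathcal A(G)_T)}.$$ A vertex is standard if it is unlooped and unmarked and has weights $\alpha=A$, $\beta=B$. If $F,H$ share precisely one vertex $a$, standard in both, the composition $F\ast H$ is obtained from the disjoint union of $F-a$ and $H-a$ by joining every neighbour of $a$ in $F$ to every neighbour of $a$ in $H$; its free loops are those of $F$ and $H$. We say that $\alpha(a),\beta(a),\alpha(a_m)\in R$ are weights for $(F,a)$ if for every $H$ in which no neighbour of $a$ is marked, $[F\ast H]=[H']+[H'_m]$,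 where $H'$ is $H$ with the weights of $a$ changed to $\alpha(a),\beta(a)$, and $H'_m$ is $H$ with $a$ marked and its weights changed to $\alpha(a_m),0$. Let $D$ be an oriented virtual link diagram, and let a circle meet $D$ in precisely four points, none of them a crossing. Let $C$ be a directed Euler system of the universe of $D$ (one directed Euler circuit in each connected component); the crossings at which $C$ does not follow the link are marked. The looped interlacement graph $\mathcal L(D,C)$ has the classical crossings as vertices, looped at negative crossings and marked at marked crossings; two vertices are adjacent if they are interlaced on a circuit of $C$; its number of free loops is one less than the number of connected components of the universe. Let the classical crossings outside the circle have arbitrary weights in $R$. Let $F$ be the graph with a standard vertex $a$ such that $F-a$ is the subgraph of $\mathcal L(D,C)$ induced by the crossings outside the circle; the neighbours of $a$ are the crossings that occur once on each of two different arcs into which the circle cuts a circuit of $C$, both arcs outside the circle; and the free loops of $F$ are the components of the universe that lie entirely outside the circle. Let $D_+$ and $D_-$ be diagrams obtained by replacing the inside of the circle with one positive, respectively negative, classical crossing (and virtual crossings as needed), in such a way that $C$ outside the circle, with the new crossing unmarked, gives Euler systems $C_\pm$ of $D_\pm$. Let $F_\pm=\mathcal L(D_\pm,C_\pm)$, where the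 new crossing has weights $\alpha=A$, $\beta=B$. Then such $D_\pm$ exist, weights for $(F,a)$ exist, and for all such weights and diagrams $$(2-d-d^{2})\,\alpha(a)=-(d+1)[F-a]+\frac{[F_{+}]+[F_{-}]}{A+B},$$ $$(2-d-d^{2})\,\beta(a)=[F-a]+\frac{(A+B+Bd)[F_{+}]-(A+Ad+B)[F_{-}]}{A^{2}-B^{2}},$$ $$(2-d-d^{2})\,\alpha(a_{m})=[F-a]+\frac{(A+B+Bd)[F_{-}]-(A+Ad+B)[F_{+}]}{A^{2}-B^{2}}.$$ Over any $R$ the formulas hold after multiplication by the denominators, and they hold as displayed when the denominators are invertible. -/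

import Mathlib

open scoped Classical

/-! ### Weighted, marked graphs and their bracket polynomials -/

/-- A weighted, marked graph with vertex set `V` and weights in `R`. Only the Boolean adjacency of
a graph matters here, so parallel edges are not recorded. `freeLoops` is the number of free loops,
i.e. of connected components that contain neither vertices nor edges. -/
structure MarkedGraph (R V : Type*) where
  /-- adjacency of distinct vertices -/
  graph : SimpleGraph V
  /-- the looped vertices -/
  looped : V → Prop
  /-- the marked vertices -/
  marked : V → Prop
  /-- the weights `α` -/
  α : V → R
  /-- the weights `β` -/
  β : V → R
  /-- the number of free loops -/
  freeLoops : ℕ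

namespace MarkedGraph

variable {R V W : Type*}

/-- The Boolean adjacency matrix over `GF(2)`, with the diagonal entries of the elements of `T`
changed. -/
noncomputable def toggledMatrix (G : MarkedGraph R V) (T : Finset V) : Matrix V V (ZMod 2) :=
  Matrix.of fun i j =>
    if i = j then (if G.looped i then 1 else 0) + (if i ∈ T then 1 else 0)
    else if G.graph.Adj i j then 1 else 0

/-- The vertices whose rows and columns survive in `𝒜(G)_T`: the row and column of `v` are removed
when `v` is marked and its (changed) diagonal entry is `0`. -/
abbrev Kept (G : MarkedGraph R V) (T : Finset V) : Type _ :=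
  {v : V // ¬ (G.marked v ∧ G.toggledMatrix T v v = 0)}

/-- The matrix `𝒜(G)_T`. -/
noncomputable def stateMatrix (G : MarkedGraph R V) (T : Finset V) :
    Matrix (G.Kept T) (G.Kept T) (ZMod 2) :=
  (G.toggledMatrix T).submatrix Subtype.val Subtype.val

/-- The `GF(2)`-nullity of `𝒜(G)_T`. -/
noncomputable def nullity [Fintype V] (G : MarkedGraph R V) (T : Finset V) : ℕ :=
  Module.finrank (ZMod 2) (LinearMap.ker (G.stateMatrix T).mulVecLin)

/-- The weighted marked-graph bracket polynomial `[G]`. -/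
noncomputable def bracket [CommRing R] [Fintype V] (d : R) (G : MarkedGraph R V) : R :=
  d ^ G.freeLoops *
    ∑ T : Finset V, (∏ v ∈ Tᶜ, G.α v) * (∏ v ∈ T, G.β v) * d ^ G.nullity T

/-- The graph `G - a`. -/
def delete (G : MarkedGraph R V) (a : V) : MarkedGraph R {v : V // v ≠ a} where
  graph := G.graph.comap Subtype.val
  looped v := G.looped v
  marked v := G.marked v
  α v := G.α v
  β v := G.β v
  freeLoops := G.freeLoops

/-- Replace the weights of the vertex `a` by `x` and `y`. -/
noncomputable def reweight (G : MarkedGraph R V) (a : V) (x y : R) : MarkedGraph R V :=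
  { G with α := Function.update G.α a x, β := Function.update G.β a y }

/-- Mark the vertex `a`. -/
def mark (G : MarkedGraph R V) (a : V) : MarkedGraph R V :=
  { G with marked := fun v => v = a ∨ G.marked v }

/-- `a` is unlooped and unmarked and has the standard weights `A` and `B`. -/
def IsStandardVertex (A B : R) (G : MarkedGraph R V) (a : V) : Prop :=
  ¬ G.looped a ∧ ¬ G.marked a ∧ G.α a = A ∧ G.β a = B

/-- The composition `F ∗ H`, where the vertex `a` of `F` is identified with the vertex `b` of `H`
(and `F`, `H` are otherwise disjoint). -/
def compose (F : MarkedGraph R V) (a : V) (H : MarkedGraph R W) (b : W) :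
    MarkedGraph R ({v : V // v ≠ a} ⊕ {w : W // w ≠ b}) where
  graph :=
    { Adj := fun x y =>
        match x, y with
        | .inl v, .inl v' => F.graph.Adj v v'
        | .inr w, .inr w' => H.graph.Adj w w'
        | .inl v, .inr w => F.graph.Adj v a ∧ H.graph.Adj b w
        | .inr w, .inl v => F.graph.Adj v a ∧ H.graph.Adj b w
      symm := ⟨by
        rintro (v | w) (v' | w') h
        · exact F.graph.adj_symm h
        · exact h
        · exact h
        · exact H.graph.adj_symm h⟩
      loopless := ⟨by
        rintro (v | w) h
        · exact F.graph.loopless.irrefl _ h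
        · exact H.graph.loopless.irrefl _ h⟩ }
  looped := Sum.elim (fun v => F.looped v) (fun w => H.looped w)
  marked := Sum.elim (fun v => F.marked v) (fun w => H.marked w)
  α := Sum.elim (fun v => F.α v) (fun w => H.α w)
  β := Sum.elim (fun v => F.β v) (fun w => H.β w)
  freeLoops := F.freeLoops + H.freeLoops

/-- `x`, `y`, `z` can serve as the weights `α(a)`, `β(a)`, `α(a_m)` that `F` and its vertex `a`
determine: for every composition `F ∗ H` with a (finite) graph `H` in which no neighbour of the
common vertex is marked, `[F ∗ H] = [H'] + [H'_m]`, where `H'` is `H` with the weights of the common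
vertex changed to `x`, `y`, and `H'_m` is `H` with the common vertex marked and its weights changed
to `z`, `0`. -/
def IsJoinWeights [CommRing R] [Fintype V] (A B d : R) (F : MarkedGraph R V) (a : V)
    (x y z : R) : Prop :=
  ∀ (W : Type) [Fintype W] (H : MarkedGraph R W) (b : W), H.IsStandardVertex A B b →
    (∀ w, H.graph.Adj b w → ¬ H.marked w) →
    (F.compose a H b).bracket d =
      (H.reweight b x y).bracket d + ((H.mark b).reweight b z 0).bracket d

end MarkedGraph

/-! ### Virtual link diagrams, Euler systems and interlacement -/

/-- An oriented virtual link diagram with set `V` of classical crossings, given by its signed Gauss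
code (virtual crossings carry no data), on which a set `P` of points that are not crossings has been
singled out. The link runs through the classical crossing `v` twice, along the overpassing strand
`(v, true)` and along the underpassing strand `(v, false)`. A node is such a passage or a point of
`P`, and `next x` is the node that the link meets after `x`. -/
structure LinkDiagram (V P : Type*) where
  /-- the node reached along the arc that leaves a node -/
  next : Equiv.Perm (V × Bool ⊕ P)
  /-- the negative crossings -/
  negative : V → Prop
  /-- the number of link components that carry neither classical crossings nor points of `P` -/
  freeLoops : ℕ

/-- `x`, `y`, `z`, `w` are distinct elements of one cycle of `σ`, met in this cyclic order. -/
def InCyclicOrder {N : Type*} (σ : Equiv.Perm N) (x y z w : N) : Prop :=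
  ∃ i j k : ℕ, 0 < i ∧ i < j ∧ j < k ∧ k < Function.minimalPeriod σ x ∧
    σ^[i] x = y ∧ σ^[j] x = z ∧ σ^[k] x = w

/-- Some cycle of `σ` meets the pairs `{x, x'}` and `{y, y'}` alternately. -/
def Alternate {N : Type*} (σ : Equiv.Perm N) (x x' y y' : N) : Prop :=
  InCyclicOrder σ x y x' y' ∨ InCyclicOrder σ x y' x' y

namespace LinkDiagram

variable {R V P : Type*}

/-- At a crossing in `M`, change to the other strand. -/
def switch (M : V → Bool) : Equiv.Perm (V × Bool ⊕ P) where
  toFun := Sum.map (fun x => (x.1, xor x.2 (M x.1))) id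
  invFun := Sum.map (fun x => (x.1, xor x.2 (M x.1))) id
  left_inv := by rintro (⟨v, s⟩ | p) <;> simp
  right_inv := by rintro (⟨v, s⟩ | p) <;> simp

/-- The directed circuits in the universe that follow the link except at the crossings in `M`, where
they arrive along one strand and leave along the other one: the circuits are the cycles of this
permutation (together with the free loops). -/
def circuits (D : LinkDiagram V P) (M : V → Bool) : Equiv.Perm (V × Bool ⊕ P) :=
  (switch M).trans D.next

/-- Two nodes are linked when an arc joins them or when they are the two passages through one
crossing. -/
inductive Linked (D : LinkDiagram V P) : V × Bool ⊕ P → V × Bool ⊕ P → Prop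
  | arc (x) : Linked D x (D.next x)
  | crossing (v) : Linked D (.inl (v, false)) (.inl (v, true))

/-- The connected components of the universe, other than the free loops. -/
def Component (D : LinkDiagram V P) : Type _ := Quot D.Linked

/-- The component of a node. -/
def component (D : LinkDiagram V P) (x : V × Bool ⊕ P) : D.Component := Quot.mk _ x

/-- The circuits that `M` determines form a directed Euler system: there is exactly one of them in
each connected component of the universe (and `M` is its set of marked crossings). -/
def IsEulerSystem (D : LinkDiagram V P) (M : V → Bool) : Prop :=
  ∀ x y, D.component x = D.component y ↔ (D.circuits M).SameCycle x y

/-- Two crossings are interlaced if they appear on a circuit in the order `v … w … v … w …`. -/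
def Interlaced (D : LinkDiagram V P) (M : V → Bool) (v w : V) : Prop :=
  Alternate (D.circuits M) (.inl (v, false)) (.inl (v, true)) (.inl (w, false)) (.inl (w, true))

/-- The looped interlacement graph `ℒ(D, C)` of a (nonempty) diagram with crossing weights `α`, `β`,
where `M` is the set of marked crossings of the Euler system `C`. It has one free loop less than the
universe has connected components, so that `[ℒ(D, C)]` is the Kauffman bracket of `D`. -/
noncomputable def interlacementGraph (D : LinkDiagram V P) (M : V → Bool) (α β : V → R) :
    MarkedGraph R V where
  graph := SimpleGraph.fromRel (D.Interlaced M)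
  looped := D.negative
  marked v := M v = true
  α := α
  β := β
  freeLoops := Nat.card D.Component + D.freeLoops - 1

end LinkDiagram

/-! ### Tangles -/

/-- A directed (virtual) tangle with set `V` of classical crossings: the part of an oriented link
diagram on one side of a circle that meets the diagram in exactly four points, none of them a
crossing. The link enters this side of the circle at two of the points and leaves it at the two
others, both numbered by `Bool`. `arc` sends the start of an arc (a passage through a crossing, or a
point of entry) to its end (a passage through a crossing, or an exit). -/
structure Tangle (V : Type*) where
  /-- the end of the arc with the given start -/
  arc : V × Bool ⊕ Bool ≃ V × Bool ⊕ Bool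
  /-- the negative crossings -/
  negative : V → Prop
  /-- the number of link components inside the tangle without classical crossings -/
  freeLoops : ℕ

namespace Tangle

variable {R V W : Type*}

/-- The nodes of a diagram divided by a circle, as starts of arcs. The points of the circle are
`inl i` (the link passes from outside to inside) and `inr o` (from inside to outside). -/
def startEquiv : (V ⊕ W) × Bool ⊕ (Bool ⊕ Bool) ≃ (V × Bool ⊕ Bool) ⊕ (W × Bool ⊕ Bool) where
  toFun
    | .inl (.inl v, s) => .inl (.inl (v, s))
    | .inl (.inr w, s) => .inr (.inl (w, s))
    | .inr (.inl i) => .inr (.inr i)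
    | .inr (.inr o) => .inl (.inr o)
  invFun
    | .inl (.inl (v, s)) => .inl (.inl v, s)
    | .inr (.inl (w, s)) => .inl (.inr w, s)
    | .inr (.inr i) => .inr (.inl i)
    | .inl (.inr o) => .inr (.inr o)
  left_inv := by rintro (⟨v | w, s⟩ | i | o) <;> rfl
  right_inv := by rintro ((⟨v, s⟩ | o) | ⟨w, s⟩ | i) <;> rfl

/-- The nodes of a diagram divided by a circle, as ends of arcs. -/
def endEquiv : (V ⊕ W) × Bool ⊕ (Bool ⊕ Bool) ≃ (V × Bool ⊕ Bool) ⊕ (W × Bool ⊕ Bool) where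
  toFun
    | .inl (.inl v, s) => .inl (.inl (v, s))
    | .inl (.inr w, s) => .inr (.inl (w, s))
    | .inr (.inl i) => .inl (.inr i)
    | .inr (.inr o) => .inr (.inr o)
  invFun
    | .inl (.inl (v, s)) => .inl (.inl v, s)
    | .inr (.inl (w, s)) => .inl (.inr w, s)
    | .inl (.inr i) => .inr (.inl i)
    | .inr (.inr o) => .inr (.inr o)
  left_inv := by rintro (⟨v | w, s⟩ | i | o) <;> rfl
  right_inv := by rintro ((⟨v, s⟩ | o) | ⟨w, s⟩ | i) <;> rfl

/-- The link diagram with the tangle `T` outside and the tangle `S` inside a circle. The exit `i` of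
`T` is the entry `i` of `S`, and the exit `o` of `S` is the entry `o` of `T`; the four points on the
circle are the distinguished points of the diagram. -/
def glue (T : Tangle V) (S : Tangle W) : LinkDiagram (V ⊕ W) (Bool ⊕ Bool) where
  next := (startEquiv.trans (Equiv.sumCongr T.arc S.arc)).trans endEquiv.symm
  negative := Sum.elim T.negative S.negative
  freeLoops := T.freeLoops + S.freeLoops

/-- The tangle with a single classical crossing: the strand that comes in at `i` becomes the strand
`f i` of the crossing, and the strand `s` of the crossing goes out at `g s`. (In a drawing this may
need virtual crossings.) -/
def oneCrossing (isNegative : Prop) (f g : Equiv.Perm Bool) : Tangle Unit where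
  arc :=
    { toFun := fun
        | .inl (_, s) => .inr (g s)
        | .inr i => .inl ((), f i)
      invFun := fun
        | .inl (_, s) => .inr (f.symm s)
        | .inr o => .inl ((), g.symm o)
      left_inv := by rintro (⟨v, s⟩ | i) <;> simp
      right_inv := by rintro (⟨v, s⟩ | i) <;> simp }
  negative _ := isNegative
  freeLoops := 0

/-- The graph `F`, with `a = none`, that arises from the tangle `T` outside a circle in the diagram
`D = glue T S` with the Euler system `C` whose marked crossings are `M`. Here `F - a` is the subgraph
of `ℒ(D, C)` induced by the crossings outside the circle. The neighbours of `a` are the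
crossings that appear on both of the paths that a circuit of `C` follows outside the circle, i.e.
those that appear alternately on a circuit with the two points where the link enters the circle; if
these two points lie on different circuits there are none. The free loops are the components of the
universe that lie outside the circle. The vertex `a` is unlooped and unmarked and has the standard
weights `A`, `B`; the crossings outside the circle have the weights `α`, `β`. -/
noncomputable def outsideGraph (T : Tangle V) (S : Tangle W) (M : V ⊕ W → Bool)
    (A B : R) (α β : V → R) : MarkedGraph R (Option V) where
  graph := SimpleGraph.fromRel fun x y =>
    match x, y with
    | some v, some w => (glue T S).Interlaced M (.inl v) (.inl w)
    | none, some v =>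
        Alternate ((glue T S).circuits M) (.inr (.inl false)) (.inr (.inl true))
          (.inl (.inl v, false)) (.inl (.inl v, true))
    | _, none => False
  looped x := ∃ v, x = some v ∧ T.negative v
  marked x := ∃ v, x = some v ∧ M (.inl v) = true
  α x := x.elim A α
  β x := x.elim B β
  freeLoops := T.freeLoops + Nat.card {c : (glue T S).Component //
    (∃ v : V, (glue T S).component (.inl (.inl v, false)) = c) ∧
      ∀ p, (glue T S).component (.inr p) ≠ c}

/-- The diagram obtained by closing the tangle `T`, which lies outside a circle, with a single
classical crossing inside the circle: `D₊` (`isNegative` false) or `D₋` (`isNegative` true). -/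
def closure (T : Tangle V) (isNegative : Prop) (f g : Equiv.Perm Bool) :
    LinkDiagram (V ⊕ Unit) (Bool ⊕ Bool) :=
  glue T (oneCrossing isNegative f g)

/-- The marks of `C` at the crossings outside the circle, with the new crossing unmarked. -/
def closedMarks (M : V ⊕ W → Bool) : V ⊕ Unit → Bool :=
  Sum.elim (fun v => M (.inl v)) (fun _ => false)

/-- The Euler system `C` with set `M` of marked crossings gives rise to an Euler system `C₊` or `C₋`
of `D₊` or `D₋`, which is the same outside the circle and follows the link at the new crossing. -/
def IsCompatible (T : Tangle V) (M : V ⊕ W → Bool) (isNegative : Prop) (f g : Equiv.Perm Bool) :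
    Prop :=
  (T.closure isNegative f g).IsEulerSystem (closedMarks M)

/-- The graph `F₊ = ℒ(D₊, C₊)` or `F₋ = ℒ(D₋, C₋)`. The new crossing has the standard weights `A`,
`B`. -/
noncomputable def closedGraph (T : Tangle V) (M : V ⊕ W → Bool) (isNegative : Prop)
    (f g : Equiv.Perm Bool) (A B : R) (α β : V → R) : MarkedGraph R (V ⊕ Unit) :=
  (T.closure isNegative f g).interlacementGraph (closedMarks M)
    (Sum.elim α fun _ => A) (Sum.elim β fun _ => B)

end Tangle

/-!
A state of `F - a`, that is, a symmetric matrix over `GF(2)` together with the indicator vector of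
the neighbours of `a`, interacts with the rest of a composition only through a line in `GF(2)²`.
There are three lines, and they are those of a vertex `a` that is unmarked with diagonal entry `0`
or `1`, or removed. Grouping the states of `F - a` by their lines therefore replaces them by three
weights at `a`. Composing `F` with nothing, an unlooped and a looped vertex shows that the brackets
of `F - a`, `F₊` and `F₋` are linear combinations of these weights, and the formulas solve the
resulting system.

For the last two compositions to be `F₊` and `F₋`, the closed diagrams must have the interlacement
that `C` has outside the circle. Whatever is inside the circle affects the circuits outside it only
through the permutation of the arc ends which sends each of them to the next one met. For `C` and
`C±` these permutations agree or differ by the transposition of the two points of entry, and in the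
second case `C±` merges two circuits of `C` into one, so that no interlacement changes.
-/

section RankOneJoin

open Matrix

variable {K m n : Type*} [Field K] [Fintype m] [Fintype n]

/-- The nullity of a square matrix. -/
noncomputable def matrixNullity (M : Matrix m m K) : ℕ :=
  Module.finrank K (LinearMap.ker M.mulVecLin)

theorem matrixNullity_submatrix (M : Matrix m m K) (e : n ≃ m) :
    matrixNullity (M.submatrix e e) = matrixNullity M := by
  have hM := M.mulVecLin.finrank_range_add_finrank_ker
  have hsub := (M.submatrix e e).mulVecLin.finrank_range_add_finrank_ker
  have hrank : (M.submatrix e e).rank = M.rank := M.rank_submatrix e e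
  simp only [rank, Module.finrank_fintype_fun_eq_card, Fintype.card_congr e] at hM hsub hrank
  simp only [matrixNullity]
  omega

/-- The block matrix that connects `P` and `Q` by the rank one matrix `a bᵀ` and its transpose: the
shape of the adjacency matrix of a composition. -/
def rankOneJoin (P : Matrix m m K) (a : m → K) (Q : Matrix n n K) (b : n → K) :
    Matrix (m ⊕ n) (m ⊕ n) K :=
  fromBlocks P (vecMulVec a b) (vecMulVec b a) Q

/-- The null vectors of `P` that are orthogonal to `a`. -/
noncomputable def orthogonalKer (P : Matrix m m K) (a : m → K) : Submodule K (m → K) :=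
  LinearMap.ker P.mulVecLin ⊓ LinearMap.ker (dotProductEquiv K m a)

/-- The relation between the output `a ⬝ᵥ x` and the input `t` of the system `P *ᵥ x + t • a = 0`.
It is all that the rest of a composition sees of `P` and `a`. -/
def response (P : Matrix m m K) (a : m → K) : Submodule K (K × K) where
  carrier := {p | ∃ x, P *ᵥ x + p.2 • a = 0 ∧ a ⬝ᵥ x = p.1}
  add_mem' := by
    rintro p q ⟨x, hx, hp⟩ ⟨y, hy, hq⟩
    refine ⟨x + y, ?_, by rw [dotProduct_add, hp, hq, Prod.fst_add]⟩
    rw [mulVec_add, Prod.snd_add, add_smul, add_add_add_comm, hx, hy, add_zero]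
  zero_mem' := ⟨0, by simp⟩
  smul_mem' := by
    rintro c p ⟨x, hx, hp⟩
    refine ⟨c • x, ?_, by rw [dotProduct_smul, hp, Prod.smul_fst]⟩
    rw [mulVec_smul, Prod.smul_snd, smul_assoc, ← smul_add, hx, smul_zero]

variable {P : Matrix m m K} {a : m → K} {Q : Matrix n n K} {b : n → K}

theorem mem_orthogonalKer {x : m → K} : x ∈ orthogonalKer P a ↔ P *ᵥ x = 0 ∧ a ⬝ᵥ x = 0 :=
  Iff.rfl

theorem mem_response {s t : K} :
    (s, t) ∈ response P a ↔ ∃ x, P *ᵥ x + t • a = 0 ∧ a ⬝ᵥ x = s :=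
  Iff.rfl

theorem rankOneJoin_mulVec_elim_eq_zero_iff {x : m → K} {y : n → K} :
    rankOneJoin P a Q b *ᵥ Sum.elim x y = 0 ↔
      P *ᵥ x + (b ⬝ᵥ y) • a = 0 ∧ Q *ᵥ y + (a ⬝ᵥ x) • b = 0 := by
  rw [rankOneJoin, fromBlocks_mulVec, Sum.elim_comp_inl, Sum.elim_comp_inr, vecMulVec_mulVec,
    vecMulVec_mulVec, op_smul_eq_smul, op_smul_eq_smul, add_comm (_ • b), ← Sum.elim_zero_zero,
    Sum.elim_eq_iff]

theorem finrank_map_add_finrank_inf_ker {E E' : Type*} [AddCommGroup E] [Module K E]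
    [FiniteDimensional K E] [AddCommGroup E'] [Module K E'] (f : E →ₗ[K] E') (p : Submodule K E) :
    Module.finrank K (p.map f) + Module.finrank K ↥(p ⊓ LinearMap.ker f) = Module.finrank K p := by
  have h := (f.domRestrict p).finrank_range_add_finrank_ker
  rwa [LinearMap.range_domRestrict, LinearMap.ker_domRestrict, ← Submodule.finrank_map_subtype_eq,
    Submodule.map_comap_subtype] at h

theorem finrank_submodule_prod {E E' : Type*} [AddCommGroup E] [Module K E]
    [FiniteDimensional K E] [AddCommGroup E'] [Module K E'] [FiniteDimensional K E']
    (p : Submodule K E) (q : Submodule K E') :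
    Module.finrank K (p.prod q) = Module.finrank K p + Module.finrank K q := by
  have hinj : Function.Injective (p.subtype.prodMap q.subtype) :=
    p.subtype_injective.prodMap q.subtype_injective
  rw [← Module.finrank_prod, ← LinearMap.finrank_range_of_inj hinj, LinearMap.range_prodMap,
    p.range_subtype, q.range_subtype]

/-- The kernel of `rankOneJoin P a Q b` is mapped by the functionals `a` and `b` of its two
components onto the common part of the two responses. -/
theorem matrixNullity_rankOneJoin (P : Matrix m m K) (a : m → K) (Q : Matrix n n K) (b : n → K) :
    matrixNullity (rankOneJoin P a Q b) =
      Module.finrank K (orthogonalKer P a) + Module.finrank K (orthogonalKer Q b) +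
        Module.finrank K
          ↥(response P a ⊓ (response Q b).comap (LinearEquiv.prodComm K K K).toLinearMap) := by
  let split := LinearEquiv.sumArrowLequivProdArrow m n K K
  let outputs := (dotProductEquiv K m a).prodMap (dotProductEquiv K n b)
  let N := (LinearMap.ker (rankOneJoin P a Q b).mulVecLin).map split.toLinearMap
  have hN (x : m → K) (y : n → K) :
      (x, y) ∈ N ↔ P *ᵥ x + (b ⬝ᵥ y) • a = 0 ∧ Q *ᵥ y + (a ⬝ᵥ x) • b = 0 := by
    rw [← rankOneJoin_mulVec_elim_eq_zero_iff]
    exact Submodule.mem_map_equiv _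
  have hrange : N.map outputs =
      response P a ⊓ (response Q b).comap (LinearEquiv.prodComm K K K).toLinearMap := by
    ext ⟨s, t⟩
    constructor
    · rintro ⟨⟨x, y⟩, hxy, hst⟩
      obtain ⟨rfl, rfl⟩ := Prod.mk.inj hst
      exact ⟨⟨x, ((hN x y).1 hxy).1, rfl⟩, y, ((hN x y).1 hxy).2, rfl⟩
    · rintro ⟨⟨x, hx, rfl⟩, y, hy, rfl⟩
      exact ⟨(x, y), (hN x y).2 ⟨hx, hy⟩, rfl⟩
  have hker : N ⊓ LinearMap.ker outputs = (orthogonalKer P a).prod (orthogonalKer Q b) := by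
    ext ⟨x, y⟩
    rw [Submodule.mem_inf, hN, LinearMap.mem_ker, Submodule.mem_prod, mem_orthogonalKer,
      mem_orthogonalKer]
    change _ ∧ (a ⬝ᵥ x, b ⬝ᵥ y) = 0 ↔ _
    rw [Prod.mk_eq_zero]
    constructor
    · rintro ⟨⟨hx, hy⟩, hax, hby⟩
      exact ⟨⟨by simpa only [hby, zero_smul, add_zero] using hx, hax⟩,
        by simpa only [hax, zero_smul, add_zero] using hy, hby⟩
    · rintro ⟨⟨hx, hax⟩, hy, hby⟩
      simp only [hx, hax, hy, hby, zero_smul, add_zero, and_self]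
  rw [matrixNullity, ← split.finrank_map_eq, ← finrank_map_add_finrank_inf_ker outputs, hrange,
    hker, finrank_submodule_prod, add_comm]

/-- The line of slope `q` in `K × K`, where the slope `none` belongs to the line on which the output
vanishes. The sign is such that the `1 × 1` matrix `q` has response `slopeLine q`. -/
def slopeLine : Option K → Submodule K (K × K)
  | some q => LinearMap.ker (LinearMap.snd K K K + q • LinearMap.fst K K K)
  | none => LinearMap.ker (LinearMap.fst K K K)

theorem mem_slopeLine_some {q s t : K} : (s, t) ∈ slopeLine (some q) ↔ t + q * s = 0 :=
  Iff.rfl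

theorem mem_slopeLine_none {s t : K} : (s, t) ∈ slopeLine (none : Option K) ↔ s = 0 :=
  Iff.rfl

theorem slopeLine_injective : Function.Injective (slopeLine (K := K)) := by
  rintro (_ | q) (_ | r) h
  · rfl
  · have : ((0 : K), (1 : K)) ∈ slopeLine (some r) := h ▸ mem_slopeLine_none.2 rfl
    simp [mem_slopeLine_some] at this
  · have : ((0 : K), (1 : K)) ∈ slopeLine (some q) := h ▸ mem_slopeLine_none.2 rfl
    simp [mem_slopeLine_some] at this
  · have : ((1 : K), -q) ∈ slopeLine (some r) := h ▸ mem_slopeLine_some.2 (by ring)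
    rw [mem_slopeLine_some, mul_one, neg_add_eq_zero] at this
    rw [this]

theorem finrank_slopeLine (q : Option K) : Module.finrank K (slopeLine q) = 1 := by
  rcases q with _ | q
  · have hspan : slopeLine none = Submodule.span K {((0 : K), (1 : K))} := by
      ext ⟨s, t⟩
      simp [mem_slopeLine_none, Submodule.mem_span_singleton, eq_comm]
    rw [hspan, finrank_span_singleton (by simp)]
  · have hspan : slopeLine (some q) = Submodule.span K {((1 : K), -q)} := by
      ext ⟨s, t⟩
      simp [mem_slopeLine_some, Submodule.mem_span_singleton, neg_eq_iff_add_eq_zero, mul_comm q,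
        add_comm t]
    rw [hspan, finrank_span_singleton (by simp)]

theorem slopeLine_inf_slopeLine_of_ne {q r : Option K} (h : q ≠ r) :
    slopeLine q ⊓ slopeLine r = ⊥ := by
  rw [Submodule.eq_bot_iff]
  rintro ⟨s, t⟩ ⟨hq, hr⟩
  rcases q with _ | q <;> rcases r with _ | r
  · exact absurd rfl h
  · have hs : s = 0 := hq
    simpa [hs, mem_slopeLine_some] using hr
  · have hs : s = 0 := hr
    simpa [hs, mem_slopeLine_some] using hq
  · have hs : s = 0 := by
      have hmul : (q - r) * s = 0 := by
        linear_combination mem_slopeLine_some.1 hq - mem_slopeLine_some.1 hr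
      exact (mul_eq_zero.1 hmul).resolve_left fun hqr => h (by rw [sub_eq_zero.1 hqr])
    simpa [hs, mem_slopeLine_some] using hq

theorem mul_comm_of_mem_response (hP : P.IsSymm) {s t s' t' : K} (h : (s, t) ∈ response P a)
    (h' : (s', t') ∈ response P a) : t * s' = t' * s := by
  obtain ⟨x, hx, rfl⟩ := h
  obtain ⟨x', hx', rfl⟩ := h'
  have hsymm : x' ⬝ᵥ P *ᵥ x = x ⬝ᵥ P *ᵥ x' := by
    rw [dotProduct_mulVec, ← mulVec_transpose, hP.eq, dotProduct_comm]
  rw [eq_neg_of_add_eq_zero_left hx, eq_neg_of_add_eq_zero_left hx'] at hsymm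
  simpa [dotProduct_comm] using hsymm

theorem exists_mem_response_ne_zero (hP : P.IsSymm) (a : m → K) : ∃ p ∈ response P a, p ≠ 0 := by
  by_cases ha : a ∈ LinearMap.range P.mulVecLin
  · obtain ⟨w, hw⟩ := ha
    refine ⟨(a ⬝ᵥ w, -1), ⟨w, ?_, rfl⟩, by simp⟩
    rw [← mulVecLin_apply, hw, neg_smul, one_smul, add_neg_cancel]
  · obtain ⟨f, hfa, hf⟩ := Submodule.exists_le_ker_of_notMem ha
    obtain ⟨u, rfl⟩ := (dotProductEquiv K m).surjective f
    refine ⟨(a ⬝ᵥ u, 0), ⟨u, ?_, rfl⟩, ?_⟩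
    · rw [zero_smul, add_zero, ← hP.eq, mulVec_transpose]
      exact dotProduct_eq_zero _ fun v => by
        rw [← dotProduct_mulVec]
        exact hf ⟨v, rfl⟩
    · intro h
      exact hfa ((dotProduct_comm u a).trans (congrArg Prod.fst h))

theorem exists_response_eq_slopeLine (hP : P.IsSymm) (a : m → K) :
    ∃ q, response P a = slopeLine q := by
  obtain ⟨⟨s, t⟩, hst, hne⟩ := exists_mem_response_ne_zero hP a
  by_cases hs : s = 0
  · have ht : t ≠ 0 := fun ht => hne (by rw [hs, ht, Prod.mk_zero_zero])
    refine ⟨none, Submodule.ext fun ⟨s', t'⟩ => ⟨fun h => ?_, fun h => ?_⟩⟩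
    · have := mul_comm_of_mem_response hP hst h
      rw [hs, mul_zero, mul_eq_zero] at this
      exact this.resolve_left ht
    · convert (response P a).smul_mem (t' / t) hst using 1
      rw [mem_slopeLine_none.1 h, hs]
      simp [ht]
  · refine ⟨some (-(t / s)), Submodule.ext fun ⟨s', t'⟩ => ⟨fun h => ?_, fun h => ?_⟩⟩
    · have := mul_comm_of_mem_response hP hst h
      rw [mem_slopeLine_some]
      field_simp
      linear_combination -this
    · convert (response P a).smul_mem (s' / s) hst using 1
      have := mem_slopeLine_some.1 h
      ext
      · simp [hs]
      · simp only [Prod.smul_mk, smul_eq_mul]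
        linear_combination this

/-- The slope of the line `response P a`. -/
noncomputable def responseSlope (hP : P.IsSymm) (a : m → K) : Option K :=
  (exists_response_eq_slopeLine hP a).choose

theorem response_eq_slopeLine_responseSlope (hP : P.IsSymm) (a : m → K) :
    response P a = slopeLine (responseSlope hP a) :=
  (exists_response_eq_slopeLine hP a).choose_spec

theorem responseSlope_eq_of_unique [Unique m] (hP : P.IsSymm) (ha : a default = 1) :
    responseSlope hP a = some (P default default) := by
  apply slopeLine_injective
  rw [← response_eq_slopeLine_responseSlope]
  ext ⟨s, t⟩
  simp only [mem_response, mem_slopeLine_some, funext_iff, Unique.forall_iff, Pi.add_apply,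
    Pi.smul_apply, Pi.zero_apply, mulVec, dotProduct, Fintype.sum_unique, ha, smul_eq_mul, mul_one,
    one_mul]
  exact ⟨fun ⟨x, hx, hs⟩ => by rw [← hs, add_comm, hx],
    fun h => ⟨fun _ => s, by rw [add_comm, h], rfl⟩⟩

theorem responseSlope_eq_of_isEmpty [IsEmpty m] (hP : P.IsSymm) (a : m → K) :
    responseSlope hP a = none := by
  apply slopeLine_injective
  rw [← response_eq_slopeLine_responseSlope]
  ext ⟨s, t⟩
  simp [mem_response, mem_slopeLine_none, eq_iff_true_of_subsingleton, eq_comm]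

theorem finrank_orthogonalKer_of_unique [Unique m] (P : Matrix m m K) (ha : a default = 1) :
    Module.finrank K (orthogonalKer P a) = 0 := by
  rw [Submodule.finrank_eq_zero, Submodule.eq_bot_iff]
  intro x hx
  have hax := (mem_orthogonalKer.1 hx).2
  rw [dotProduct, Fintype.sum_unique, ha, one_mul] at hax
  exact funext (Unique.forall_iff.2 hax)

variable [DecidableEq K]

/-- The slope of the mirror image of a line in the diagonal. -/
def slopeDual : Option K → Option K
  | some q => if q = 0 then none else some q⁻¹
  | none => some 0

theorem comap_prodComm_slopeLine (q : Option K) :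
    (slopeLine q).comap (LinearEquiv.prodComm K K K).toLinearMap = slopeLine (slopeDual q) := by
  ext ⟨s, t⟩
  change (t, s) ∈ slopeLine q ↔ _
  rcases q with _ | q
  · simp [slopeDual, mem_slopeLine_none, mem_slopeLine_some]
  · by_cases hq : q = 0
    · simp [slopeDual, hq, mem_slopeLine_none, mem_slopeLine_some]
    · simp only [slopeDual, hq, if_false, mem_slopeLine_some]
      field_simp
      rw [mul_zero, add_comm, mul_comm]

theorem finrank_slopeLine_inf_slopeLine (q r : Option K) :
    Module.finrank K ↥(slopeLine q ⊓ slopeLine r) = if q = r then 1 else 0 := by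
  split_ifs with h
  · rw [h, inf_idem, finrank_slopeLine]
  · rw [slopeLine_inf_slopeLine_of_ne h, finrank_bot]

theorem matrixNullity_rankOneJoin_of_isSymm (hP : P.IsSymm) (a : m → K) (hQ : Q.IsSymm)
    (b : n → K) :
    matrixNullity (rankOneJoin P a Q b) =
      Module.finrank K (orthogonalKer P a) + Module.finrank K (orthogonalKer Q b) +
        if responseSlope hP a = slopeDual (responseSlope hQ b) then 1 else 0 := by
  rw [matrixNullity_rankOneJoin, response_eq_slopeLine_responseSlope hP,
    response_eq_slopeLine_responseSlope hQ, comap_prodComm_slopeLine,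
    finrank_slopeLine_inf_slopeLine]

end RankOneJoin

namespace MarkedGraph

section StateSum

variable {R V W X Y : Type*}

/-- The product of the weights that belongs to the state `T`. -/
noncomputable def stateWeight [CommRing R] [Fintype V] (G : MarkedGraph R V) (T : Finset V) : R :=
  ∏ v, if v ∈ T then G.β v else G.α v

theorem bracket_eq_sum_stateWeight [CommRing R] [Fintype V] (d : R) (G : MarkedGraph R V) :
    G.bracket d = d ^ G.freeLoops * ∑ T, G.stateWeight T * d ^ G.nullity T := by
  rw [bracket]
  congr 1
  refine Finset.sum_congr rfl fun T _ => ?_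
  rw [stateWeight, Finset.prod_ite, Finset.filter_mem_eq_inter, Finset.univ_inter,
    Finset.filter_notMem_eq_sdiff, ← Finset.compl_eq_univ_sdiff, mul_comm (∏ v ∈ Tᶜ, G.α v)]

theorem bracket_congr [CommRing R] [Fintype V] [Fintype W] (d : R) (e : V ≃ W)
    {G : MarkedGraph R V} {H : MarkedGraph R W}
    (hadj : ∀ u v, H.graph.Adj (e u) (e v) ↔ G.graph.Adj u v)
    (hlooped : ∀ v, H.looped (e v) ↔ G.looped v) (hmarked : ∀ v, H.marked (e v) ↔ G.marked v)
    (hα : ∀ v, H.α (e v) = G.α v) (hβ : ∀ v, H.β (e v) = G.β v)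
    (hfree : H.freeLoops = G.freeLoops) : G.bracket d = H.bracket d := by
  rw [bracket_eq_sum_stateWeight, bracket_eq_sum_stateWeight, hfree]
  congr 1
  refine Fintype.sum_equiv e.finsetCongr _ _ fun T => ?_
  have htoggled (u v) :
      H.toggledMatrix (e.finsetCongr T) (e u) (e v) = G.toggledMatrix T u v := by
    simp [toggledMatrix, hadj, hlooped]
  have hkept (v) : ¬ (G.marked v ∧ G.toggledMatrix T v v = 0) ↔
      ¬ (H.marked (e v) ∧ H.toggledMatrix (e.finsetCongr T) (e v) (e v) = 0) := by
    rw [htoggled, hmarked]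
  have hmatrix : (H.stateMatrix (e.finsetCongr T)).submatrix (e.subtypeEquiv hkept)
      (e.subtypeEquiv hkept) = G.stateMatrix T :=
    Matrix.ext fun u v => htoggled u v
  have hnullity : G.nullity T = H.nullity (e.finsetCongr T) := by
    rw [nullity, ← hmatrix]
    exact matrixNullity_submatrix _ _
  rw [hnullity]
  congr 1
  exact Fintype.prod_equiv e _ _ fun v => by simp [hα, hβ]

theorem toggledMatrix_isSymm (G : MarkedGraph R V) (T : Finset V) :
    (G.toggledMatrix T).IsSymm := by
  ext i j
  by_cases h : i = j
  · rw [h, Matrix.transpose_apply]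
  · simp [toggledMatrix, h, Ne.symm h, G.graph.adj_comm]

theorem stateMatrix_isSymm (G : MarkedGraph R V) (T : Finset V) :
    (G.stateMatrix T).IsSymm :=
  (G.toggledMatrix_isSymm T).submatrix _

end StateSum

section Join

variable {R V W X Y : Type*}

/-- Two graphs connected by all edges between the vertices in `N` and those in `N'`. -/
def join (G : MarkedGraph R X) (N : X → Prop) (H : MarkedGraph R Y) (N' : Y → Prop) :
    MarkedGraph R (X ⊕ Y) where
  graph :=
    { Adj := fun x y =>
        match x, y with
        | .inl v, .inl v' => G.graph.Adj v v'
        | .inr w, .inr w' => H.graph.Adj w w'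
        | .inl v, .inr w => N v ∧ N' w
        | .inr w, .inl v => N v ∧ N' w
      symm := ⟨by
        rintro (v | w) (v' | w') h
        · exact G.graph.adj_symm h
        · exact h
        · exact h
        · exact H.graph.adj_symm h⟩
      loopless := ⟨by
        rintro (v | w) h
        · exact G.graph.loopless.irrefl _ h
        · exact H.graph.loopless.irrefl _ h⟩ }
  looped := Sum.elim G.looped H.looped
  marked := Sum.elim G.marked H.marked
  α := Sum.elim G.α H.α
  β := Sum.elim G.β H.β
  freeLoops := G.freeLoops + H.freeLoops

theorem compose_eq_join (F : MarkedGraph R V) (a : V) (H : MarkedGraph R W) (b : W) :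
    F.compose a H b =
      (F.delete a).join (fun v => F.graph.Adj v a) (H.delete b) (fun w => H.graph.Adj b w) := by
  unfold compose join
  congr 2
  ext (v | w) (v' | w') <;> rfl

/-- The indicator vector of a set of vertices. -/
noncomputable def indicator (N : V → Prop) (v : V) : ZMod 2 :=
  if N v then 1 else 0

theorem toggledMatrix_join (G : MarkedGraph R X) (N : X → Prop) (H : MarkedGraph R Y)
    (N' : Y → Prop) (T : Finset X) (U : Finset Y) :
    (G.join N H N').toggledMatrix (T.disjSum U) =
      Matrix.fromBlocks (G.toggledMatrix T) (Matrix.vecMulVec (indicator N) (indicator N'))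
        (Matrix.vecMulVec (indicator N') (indicator N)) (H.toggledMatrix U) := by
  ext (u | u) (v | v)
  · simp only [toggledMatrix, join, Matrix.of_apply, Matrix.fromBlocks_apply₁₁, Sum.inl.injEq,
      Finset.inl_mem_disjSum, Sum.elim_inl]
    congr!
  · by_cases hu : N u <;> simp [toggledMatrix, join, indicator, Matrix.vecMulVec, hu]
  · by_cases hv : N v <;> simp [toggledMatrix, join, indicator, Matrix.vecMulVec, hv]
  · simp only [toggledMatrix, join, Matrix.of_apply, Matrix.fromBlocks_apply₂₂, Sum.inr.injEq,
      Finset.inr_mem_disjSum, Sum.elim_inr]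
    congr!

theorem nullity_join [Fintype X] [Fintype Y] (G : MarkedGraph R X) (N : X → Prop)
    (H : MarkedGraph R Y) (N' : Y → Prop) (T : Finset X) (U : Finset Y) :
    (G.join N H N').nullity (T.disjSum U) =
      matrixNullity (rankOneJoin (G.stateMatrix T) (indicator N ∘ Subtype.val) (H.stateMatrix U)
        (indicator N' ∘ Subtype.val)) := by
  let J := G.join N H N'
  have hblocks := G.toggledMatrix_join N H N' T U
  have hl (v : X) : ¬ (J.marked (.inl v) ∧ J.toggledMatrix (T.disjSum U) (.inl v) (.inl v) = 0) ↔
      ¬ (G.marked v ∧ G.toggledMatrix T v v = 0) := by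
    rw [hblocks]
    rfl
  have hr (v : Y) : ¬ (J.marked (.inr v) ∧ J.toggledMatrix (T.disjSum U) (.inr v) (.inr v) = 0) ↔
      ¬ (H.marked v ∧ H.toggledMatrix U v v = 0) := by
    rw [hblocks]
    rfl
  let e : J.Kept (T.disjSum U) ≃ G.Kept T ⊕ H.Kept U :=
    Equiv.subtypeSum.trans
      (Equiv.sumCongr (Equiv.subtypeEquivRight hl) (Equiv.subtypeEquivRight hr))
  have hmatrix : (J.stateMatrix (T.disjSum U)).submatrix e.symm e.symm =
      rankOneJoin (G.stateMatrix T) (indicator N ∘ Subtype.val) (H.stateMatrix U)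
        (indicator N' ∘ Subtype.val) := by
    ext (u | u) (v | v) <;> exact congrFun₂ hblocks _ _
  rw [← hmatrix, matrixNullity_submatrix]
  rfl

theorem stateWeight_join [CommRing R] [Fintype X] [Fintype Y] (G : MarkedGraph R X) (N : X → Prop)
    (H : MarkedGraph R Y) (N' : Y → Prop) (T : Finset X) (U : Finset Y) :
    (G.join N H N').stateWeight (T.disjSum U) = G.stateWeight T * H.stateWeight U := by
  simp [stateWeight, join, Fintype.prod_sum_type]

end Join

section Profile

/-- The function with the values `x`, `y`, `z` at the slopes `0`, `1`, `∞`. -/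
def slopeWeights {R : Type*} (x y z : R) : Option (ZMod 2) → R
  | some q => if q = 0 then x else y
  | none => z

theorem funext_slope {R : Type*} {f g : Option (ZMod 2) → R} (hzero : f (some 0) = g (some 0))
    (hone : f (some 1) = g (some 1)) (hnone : f none = g none) : f = g := by
  funext q
  rcases q with _ | q
  · exact hnone
  · fin_cases q
    · exact hzero
    · exact hone

theorem slopeWeights_eta {R : Type*} (f : Option (ZMod 2) → R) :
    slopeWeights (f (some 0)) (f (some 1)) (f none) = f :=
  funext_slope rfl rfl rfl

variable {R V X Y : Type*} [CommRing R] [Fintype V] [Fintype X] [Fintype Y]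

/-- The slope of the response of the state `T` of `G` to the edges that arrive at the vertices in
`N`. -/
noncomputable def stateSlope (G : MarkedGraph R V) (N : V → Prop) (T : Finset V) :
    Option (ZMod 2) :=
  responseSlope (G.stateMatrix_isSymm T) (indicator N ∘ Subtype.val)

/-- The part of the nullity of the state `T` of `G` that every join along `N` retains. -/
noncomputable def residualNullity (G : MarkedGraph R V) (N : V → Prop) (T : Finset V) : ℕ :=
  Module.finrank (ZMod 2) (orthogonalKer (G.stateMatrix T) (indicator N ∘ Subtype.val))

/-- The state sum of `G`, sorted by the response of the states at the vertices in `N`. -/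
noncomputable def profile (d : R) (G : MarkedGraph R V) (N : V → Prop) (q : Option (ZMod 2)) : R :=
  d ^ G.freeLoops *
    ∑ T with G.stateSlope N T = q, G.stateWeight T * d ^ G.residualNullity N T

theorem sum_fiberwise_mul {ι κ : Type*} [Fintype ι] [Fintype κ] [DecidableEq κ] (f : ι → R)
    (σ : ι → κ) (c : κ → R) :
    ∑ q, (∑ i with σ i = q, f i) * c q = ∑ i, f i * c (σ i) := by
  rw [← Finset.sum_fiberwise _ σ]
  refine Finset.sum_congr rfl fun q _ => ?_
  rw [Finset.sum_mul]
  refine Finset.sum_congr rfl fun i hi => ?_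
  rw [(Finset.mem_filter.1 hi).2]

/-- The bilinear form that computes the bracket of a join from the profiles of its two parts. -/
def pairing (d : R) (f g : Option (ZMod 2) → R) : R :=
  ∑ q, ∑ r, f q * g r * if q = slopeDual r then d else 1

theorem pairing_profile (d : R) (G : MarkedGraph R X) (N : X → Prop) (H : MarkedGraph R Y)
    (N' : Y → Prop) :
    pairing d (G.profile d N) (H.profile d N') = d ^ (G.freeLoops + H.freeLoops) *
      ∑ T, ∑ U, G.stateWeight T * d ^ G.residualNullity N T *
        (H.stateWeight U * d ^ H.residualNullity N' U *
          if G.stateSlope N T = slopeDual (H.stateSlope N' U) then d else 1) := by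
  rw [pairing, pow_add, mul_assoc]
  simp only [profile, mul_assoc, mul_left_comm _ (d ^ H.freeLoops), ← Finset.mul_sum,
    sum_fiberwise_mul _ _ fun r => ite (_ = slopeDual r) d 1, sum_fiberwise_mul]

theorem bracket_join (d : R) (G : MarkedGraph R X) (N : X → Prop) (H : MarkedGraph R Y)
    (N' : Y → Prop) :
    (G.join N H N').bracket d = pairing d (G.profile d N) (H.profile d N') := by
  have hpow (T : Finset X) (U : Finset Y) :
      d ^ (G.join N H N').nullity (T.disjSum U) =
        d ^ G.residualNullity N T * d ^ H.residualNullity N' U *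
          if G.stateSlope N T = slopeDual (H.stateSlope N' U) then d else 1 := by
    rw [nullity_join, matrixNullity_rankOneJoin_of_isSymm (G.stateMatrix_isSymm T) _
      (H.stateMatrix_isSymm U), pow_add, pow_add, pow_ite, pow_one, pow_zero]
    rfl
  rw [bracket_eq_sum_stateWeight, pairing_profile, ← Fintype.sum_prod_type']
  congr 1
  refine (Fintype.sum_equiv Finset.sumEquiv.symm.toEquiv _ _ fun ⟨T, U⟩ => ?_).symm
  change _ = (G.join N H N').stateWeight (T.disjSum U) * d ^ (G.join N H N').nullity (T.disjSum U)
  rw [hpow, stateWeight_join]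
  ring

theorem pairing_slopeWeights (d x y z x' y' z' : R) :
    pairing d (slopeWeights x y z) (slopeWeights x' y' z') =
      (x + y + z) * (x' + y' + z') + (d - 1) * (x * z' + y * y' + z * x') := by
  have hsum (f : ZMod 2 → R) : ∑ q, f q = f 0 + f 1 := Fin.sum_univ_two f
  simp only [pairing, slopeWeights, slopeDual, Fintype.sum_option, mul_ite, ite_mul, hsum,
    ↓reduceIte, mul_one, one_ne_zero, inv_one, reduceCtorEq, Option.some.injEq, zero_ne_one]
  ring

theorem pairing_slopeWeights_add (d x y z : R) (f : Option (ZMod 2) → R) :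
    pairing d (slopeWeights x y 0) f + pairing d (slopeWeights 0 0 z) f =
      pairing d (slopeWeights x y z) f := by
  rw [← slopeWeights_eta f]
  simp only [pairing_slopeWeights]
  ring

theorem profile_of_isEmpty [IsEmpty V] (d : R) (G : MarkedGraph R V) (N : V → Prop)
    (hfree : G.freeLoops = 0) : G.profile d N = slopeWeights 0 0 1 := by
  funext q
  have hslope (T) : G.stateSlope N T = none := responseSlope_eq_of_isEmpty _ _
  have hresidual (T) : G.residualNullity N T = 0 := Module.finrank_zero_of_subsingleton
  rcases q with _ | q <;>
    simp [profile, hslope, hresidual, stateWeight, slopeWeights, hfree]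

end Profile

section Single

variable {R Y : Type*}

/-- The graph with a single vertex and no free loops. -/
def single (looped marked : Prop) (x y : R) : MarkedGraph R Unit where
  graph := ⊥
  looped _ := looped
  marked _ := marked
  α _ := x
  β _ := y
  freeLoops := 0

theorem reweight_join_single (marked : Prop) (u v x y : R) (H : MarkedGraph R Y) (N : Y → Prop) :
    ((single False marked u v).join (fun _ => True) H N).reweight (.inl ()) x y =
      (single False marked x y).join (fun _ => True) H N := by
  simp only [reweight, single, join, mk.injEq, true_and, and_true]
  constructor <;> ext (w | w) <;> simp

theorem mark_join_single (u v : R) (H : MarkedGraph R Y) (N : Y → Prop) :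
    ((single False False u v).join (fun _ => True) H N).mark (.inl ()) =
      (single False True u v).join (fun _ => True) H N := by
  simp only [mark, single, join, mk.injEq, true_and, and_true]
  ext (w | w) <;> simp

theorem toggledMatrix_single (looped marked : Prop) (x y : R) (T : Finset Unit) :
    (single looped marked x y).toggledMatrix T () () =
      (if looped then 1 else 0) + if () ∈ T then 1 else 0 := by
  rw [toggledMatrix, Matrix.of_apply, if_pos rfl]
  congr!

theorem sum_finset_unit {M : Type*} [AddCommMonoid M] (f : Finset Unit → M) :
    ∑ T, f T = f ∅ + f {()} :=
  Finset.sum_pair (a := (∅ : Finset Unit)) (b := {()}) (by decide)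

variable [CommRing R]

theorem profile_single (d : R) (looped marked : Prop) (x y : R) (N : Unit → Prop)
    (q : Option (ZMod 2)) :
    let G := single looped marked x y
    G.profile d N q = (if G.stateSlope N ∅ = q then x * d ^ G.residualNullity N ∅ else 0) +
      if G.stateSlope N {()} = q then y * d ^ G.residualNullity N {()} else 0 := by
  intro G
  have hfree : G.freeLoops = 0 := rfl
  have hempty : G.stateWeight ∅ = x := by simp [G, stateWeight, single]
  have hfull : G.stateWeight {()} = y := by simp [G, stateWeight, single]
  rw [profile, Finset.sum_filter, sum_finset_unit, hfree, hempty, hfull, pow_zero, one_mul]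

theorem profile_single_unmarked (d x y : R) (looped : Prop) :
    (single looped False x y).profile d (fun _ => True) =
      if looped then slopeWeights y x 0 else slopeWeights x y 0 := by
  let hunique (T) : Unique ((single looped False x y).Kept T) :=
    (Equiv.subtypeUnivEquiv fun _ h => h.1).unique
  have hslope (T) : (single looped False x y).stateSlope (fun _ => True) T =
      some ((if looped then 1 else 0) + if () ∈ T then 1 else 0) := by
    rw [← toggledMatrix_single looped False x y T]
    exact responseSlope_eq_of_unique _ (if_pos trivial)
  have hresidual (T) : (single looped False x y).residualNullity (fun _ => True) T = 0 :=
    finrank_orthogonalKer_of_unique _ (if_pos trivial)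
  by_cases hl : looped <;>
    apply funext_slope <;>
    simp only [profile_single, hslope, hresidual] <;>
    simp [hl, slopeWeights, CharTwo.add_self_eq_zero]

theorem profile_single_marked (d z : R) :
    (single False True z 0).profile d (fun _ => True) = slopeWeights 0 0 z := by
  have : IsEmpty ((single False True z 0).Kept ∅) :=
    ⟨fun v => v.2 ⟨trivial, (toggledMatrix_single ..).trans (by simp)⟩⟩
  have hslope : (single False True z 0).stateSlope (fun _ => True) ∅ = none :=
    responseSlope_eq_of_isEmpty _ _
  have hresidual : (single False True z 0).residualNullity (fun _ => True) ∅ = 0 :=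
    Module.finrank_zero_of_subsingleton
  apply funext_slope <;>
    simp [profile_single, hslope, hresidual, slopeWeights]

end Single

section JoinWeights

variable {R V W : Type*}

/-- A vertex of a type and the other ones. -/
noncomputable def unitSumEquiv (b : W) : Unit ⊕ {w : W // w ≠ b} ≃ W :=
  (Equiv.sumCongr (Equiv.ofUnique Unit {w : W // w = b}) (Equiv.refl _)).trans
    (Equiv.sumCompl fun w => w = b)

@[simp] theorem unitSumEquiv_inl (b : W) (u : Unit) : unitSumEquiv b (.inl u) = b :=
  (Equiv.ofUnique Unit {w : W // w = b} u).2

@[simp] theorem unitSumEquiv_inr (b : W) (w : {w : W // w ≠ b}) :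
    unitSumEquiv b (.inr w) = w :=
  rfl

variable [CommRing R]

theorem bracket_reweight [Fintype W] (d x y : R) (H : MarkedGraph R W) (b : W)
    (hlooped : ¬ H.looped b) (hmarked : ¬ H.marked b) :
    (H.reweight b x y).bracket d =
      ((single False False x y).join (fun _ => True) (H.delete b)
        (fun w => H.graph.Adj b w)).bracket d := by
  refine (bracket_congr d (unitSumEquiv b) ?_ ?_ ?_ ?_ ?_ (Nat.zero_add _).symm).symm
  · rintro (u | u) (v | v) <;> simp [join, single, reweight, delete, H.graph.adj_comm]
  · rintro (u | u) <;> simp [join, single, reweight, delete, hlooped]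
  · rintro (u | u) <;> simp [join, single, reweight, delete, hmarked]
  · rintro (u | ⟨w, hw⟩)
    · simp [join, single, reweight]
    · simp [join, reweight, delete, hw]
  · rintro (u | ⟨w, hw⟩)
    · simp [join, single, reweight]
    · simp [join, reweight, delete, hw]

theorem bracket_mark_reweight [Fintype W] (d x y : R) (H : MarkedGraph R W) (b : W)
    (hlooped : ¬ H.looped b) :
    ((H.mark b).reweight b x y).bracket d =
      ((single False True x y).join (fun _ => True) (H.delete b)
        (fun w => H.graph.Adj b w)).bracket d := by
  refine (bracket_congr d (unitSumEquiv b) ?_ ?_ ?_ ?_ ?_ (Nat.zero_add _).symm).symm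
  · rintro (u | u) (v | v) <;> simp [join, single, reweight, delete, mark, H.graph.adj_comm]
  · rintro (u | u) <;> simp [join, single, reweight, delete, mark, hlooped]
  · rintro (u | ⟨w, hw⟩)
    · simp [join, single, reweight, mark]
    · simp [join, reweight, delete, mark, hw]
  · rintro (u | ⟨w, hw⟩)
    · simp [join, single, reweight]
    · simp [join, reweight, delete, mark, hw]
  · rintro (u | ⟨w, hw⟩)
    · simp [join, single, reweight]
    · simp [join, reweight, delete, mark, hw]

variable [Fintype V]

theorem exists_isJoinWeights (A B d : R) (F : MarkedGraph R V) (a : V) :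
    ∃ x y z : R, F.IsJoinWeights A B d a x y z := by
  let p := (F.delete a).profile d (fun v => F.graph.Adj v a)
  refine ⟨p (some 0), p (some 1), p none, fun W _ H b hb _ => ?_⟩
  rw [bracket_reweight d _ _ H b hb.1 hb.2.1, bracket_mark_reweight d _ _ H b hb.1,
    compose_eq_join, bracket_join, bracket_join, bracket_join, profile_single_unmarked,
    profile_single_marked, if_neg not_false, pairing_slopeWeights_add, slopeWeights_eta]

namespace IsJoinWeights

variable {A B d x y z : R} {F : MarkedGraph R V} {a : V}

theorem bracket_join [Fintype {v // v ≠ a}] (h : F.IsJoinWeights A B d a x y z) {Y : Type}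
    [Fintype Y] (K : MarkedGraph R Y) (N : Y → Prop) (hN : ∀ w, N w → ¬ K.marked w) :
    ((F.delete a).join (fun v => F.graph.Adj v a) K N).bracket d =
      pairing d (slopeWeights x y z) (K.profile d N) := by
  let H := (single False False A B).join (fun _ => True) K N
  have hmarked (w) (hw : H.graph.Adj (.inl ()) w) : ¬ H.marked w := by
    rcases w with _ | w
    · exact not_false
    · exact hN w hw.2
  have hH := h (Unit ⊕ Y) H (.inl ()) ⟨not_false, not_false, rfl, rfl⟩ hmarked
  rw [mark_join_single, reweight_join_single, reweight_join_single, MarkedGraph.bracket_join,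
    MarkedGraph.bracket_join, profile_single_unmarked, profile_single_marked, if_neg not_false,
    pairing_slopeWeights_add] at hH
  have hinr : Function.Bijective fun w : Y => (⟨.inr w, Sum.inr_ne_inl⟩ :
      {w : Unit ⊕ Y // w ≠ .inl ()}) :=
    ⟨fun w w' hw => Sum.inr_injective (congrArg Subtype.val hw),
      by rintro ⟨_ | w, hw⟩; exacts [absurd rfl hw, ⟨w, rfl⟩]⟩
  refine (bracket_congr (H := F.compose a H (.inl ())) d
    (Equiv.sumCongr (Equiv.refl _) (Equiv.ofBijective _ hinr)) ?_ ?_ ?_ ?_ ?_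
    (congrArg _ (Nat.zero_add _))).trans (.trans (by congr!) hH)
  · rintro (v | w) (v' | w') <;> simp [H, join, compose, delete]
  all_goals rintro (v | w) <;> simp [H, join, compose, delete]

theorem bracket_delete [Fintype {v // v ≠ a}] (h : F.IsJoinWeights A B d a x y z) :
    (F.delete a).bracket d = d * x + y + z := by
  let K : MarkedGraph R Empty := ⟨⊥, fun _ => False, fun _ => False, fun _ => 0, fun _ => 0, 0⟩
  have hK := h.bracket_join K (fun _ => True) (fun w => w.elim)
  rw [profile_of_isEmpty d K _ rfl, pairing_slopeWeights] at hK
  rw [bracket_congr d (Equiv.sumEmpty _ Empty).symm (H := (F.delete a).join _ K _)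
    (fun _ _ => Iff.rfl) (fun _ => Iff.rfl) (fun _ => Iff.rfl) (fun _ => rfl) (fun _ => rfl) rfl,
    hK]
  ring

theorem bracket_join_single_unlooped [Fintype {v // v ≠ a}] (h : F.IsJoinWeights A B d a x y z) :
    ((F.delete a).join (fun v => F.graph.Adj v a) (single False False A B)
        fun _ => True).bracket d =
      (A + B) * x + (A + B * d) * y + (A * d + B) * z := by
  rw [h.bracket_join _ _ fun _ _ => not_false, profile_single_unmarked, if_neg not_false,
    pairing_slopeWeights]
  ring

theorem bracket_join_single_looped [Fintype {v // v ≠ a}] (h : F.IsJoinWeights A B d a x y z) :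
    ((F.delete a).join (fun v => F.graph.Adj v a) (single True False A B)
        fun _ => True).bracket d =
      (A + B) * x + (B + A * d) * y + (B * d + A) * z := by
  rw [h.bracket_join _ _ fun _ _ => not_false, profile_single_unmarked, if_pos trivial,
    pairing_slopeWeights]
  ring

end IsJoinWeights

end JoinWeights

end MarkedGraph

section Circuits

open Equiv.Perm (SameCycle)

variable {N K : Type*} {σ : Equiv.Perm N} {x x' y y' z w : N}

theorem InCyclicOrder.rotate (h : InCyclicOrder σ x y z w) : InCyclicOrder σ y z w x := by
  obtain ⟨i, j, k, hi, hij, hjk, hk, rfl, rfl, rfl⟩ := h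
  have hx : x ∈ Function.periodicPts σ :=
    Function.minimalPeriod_pos_iff_mem_periodicPts.1 (by omega)
  refine ⟨j - i, k - i, Function.minimalPeriod σ x - i, by omega, by omega, by omega, ?_, ?_, ?_,
    ?_⟩
  · rw [Function.minimalPeriod_apply_iterate hx]
    omega
  · rw [← Function.iterate_add_apply, Nat.sub_add_cancel (by omega)]
  · rw [← Function.iterate_add_apply, Nat.sub_add_cancel (by omega)]
  · rw [← Function.iterate_add_apply, Nat.sub_add_cancel (by omega),
      Function.iterate_minimalPeriod]

theorem Alternate.symm (h : Alternate σ x x' y y') : Alternate σ y y' x x' :=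
  h.elim (fun h => .inr h.rotate) (fun h => .inl h.rotate.rotate.rotate)

theorem alternate_comm : Alternate σ x x' y y' ↔ Alternate σ y y' x x' :=
  ⟨Alternate.symm, Alternate.symm⟩

theorem Alternate.swap_left (h : Alternate σ x x' y y') : Alternate σ x' x y y' :=
  h.elim (fun h => .inr h.rotate.rotate) (fun h => .inl h.rotate.rotate)

theorem sameCycle_iterate (σ : Equiv.Perm N) (n : ℕ) (x : N) : SameCycle σ x (σ^[n] x) :=
  ⟨n, by simp [Equiv.Perm.iterate_eq_pow]⟩

theorem Alternate.sameCycle (h : Alternate σ x x' y y') : SameCycle σ x x' ∧ SameCycle σ x y := by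
  rcases h with ⟨i, j, k, -, -, -, -, rfl, rfl, -⟩ | ⟨i, j, k, -, -, -, -, -, rfl, rfl⟩
  all_goals exact ⟨sameCycle_iterate _ _ _, sameCycle_iterate _ _ _⟩

theorem exists_pos_iterate_eq [Finite N] (h : SameCycle σ x y) : ∃ n, 0 < n ∧ σ^[n] x = y := by
  obtain ⟨n, hn, -, h⟩ := h.exists_pow_eq''
  exact ⟨n, hn, by rw [Equiv.Perm.iterate_eq_pow, h]⟩

theorem mem_of_sameCycle [Finite N] {C : Set N} (hC : Set.MapsTo σ C C) (h : SameCycle σ x y)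
    (hx : x ∈ C) : y ∈ C := by
  obtain ⟨n, -, rfl⟩ := exists_pos_iterate_eq h
  exact hC.iterate n hx

theorem exists_exit_of_iterate {C : Set N} {m n : ℕ} (hmn : m ≤ n) (hm : σ^[m] x ∈ C)
    (hn : σ^[n] x ∉ C) : ∃ s, m ≤ s ∧ s < n ∧ σ^[s] x ∈ C ∧ σ (σ^[s] x) ∉ C := by
  induction n, hmn using Nat.le_induction with
  | base => exact absurd hm hn
  | succ n hmn ih =>
    by_cases h : σ^[n] x ∈ C
    · exact ⟨n, hmn, n.lt_succ_self, h, Function.iterate_succ_apply' σ n x ▸ hn⟩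
    · obtain ⟨s, hms, hsn, hs⟩ := ih h
      exact ⟨s, hms, hsn.trans n.lt_succ_self, hs⟩

theorem not_inCyclicOrder_of_exit_unique {C : Set N}
    (hC : ∀ x ∈ C, ∀ y ∈ C, σ x ∉ C → σ y ∉ C → x = y) (hx : x ∈ C) (hy : y ∉ C)
    (hz : z ∈ C) (hw : w ∉ C) : ¬ InCyclicOrder σ x y z w := by
  rintro ⟨i, j, k, hi, hij, hjk, hk, rfl, rfl, rfl⟩
  obtain ⟨s, -, hsi, hs, hs'⟩ := exists_exit_of_iterate (m := 0) hi.le hx hy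
  obtain ⟨t, hjt, htk, ht, ht'⟩ := exists_exit_of_iterate hjk.le hz hw
  have hst : s = t := Function.iterate_injOn_Iio_minimalPeriod
    (Set.mem_Iio.2 (by omega : s < _)) (Set.mem_Iio.2 (by omega : t < _)) (hC _ hs _ ht hs' ht')
  omega

/-- `y` is the first element of `R` on the orbit of `x` under `σ` after `x` itself. -/
def FirstHit (σ : Equiv.Perm N) (R : Set N) (x y : N) : Prop :=
  y ∈ R ∧ ∃ k, 0 < k ∧ σ^[k] x = y ∧ ∀ j, 0 < j → j < k → σ^[j] x ∉ R

namespace FirstHit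

variable {R : Set N}

theorem of_mem (h : σ x ∈ R) : FirstHit σ R x (σ x) :=
  ⟨h, 1, one_pos, rfl, fun j hj hj1 => by omega⟩

theorem of_notMem (hx : σ x ∉ R) (h : FirstHit σ R (σ x) y) : FirstHit σ R x y := by
  obtain ⟨hy, k, -, hky, hmin⟩ := h
  refine ⟨hy, k + 1, k.succ_pos, hky, fun j hj hjk => ?_⟩
  obtain ⟨j, rfl⟩ := Nat.exists_eq_succ_of_ne_zero hj.ne'
  rcases Nat.eq_zero_or_pos j with rfl | hj
  · exact hx
  · exact hmin j hj (by omega)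

theorem right_unique (h : FirstHit σ R x y) (h' : FirstHit σ R x z) : y = z := by
  obtain ⟨hy, k, hk, rfl, hmin⟩ := h
  obtain ⟨hz, l, hl, rfl, hmin'⟩ := h'
  rcases lt_trichotomy k l with hkl | rfl | hkl
  · exact absurd hy (hmin' k hk hkl)
  · rfl
  · exact absurd hz (hmin l hl hkl)

theorem left_unique (h : FirstHit σ R x z) (h' : FirstHit σ R y z) (hx : x ∈ R) (hy : y ∈ R) :
    x = y := by
  obtain ⟨-, k, hk, hkz, hmin⟩ := h
  obtain ⟨-, l, hl, hlz, hmin'⟩ := h'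
  wlog hkl : k ≤ l generalizing x y k l
  · exact (this hy hx l hl hlz hmin' k hk hkz hmin (by omega)).symm
  have hlk : σ^[l - k] y = x := by
    apply σ.injective.iterate k
    rw [← Function.iterate_add_apply, Nat.add_sub_cancel' hkl, hkz, hlz]
  rcases Nat.eq_zero_or_pos (l - k) with h0 | h0
  · rw [h0] at hlk
    exact hlk.symm
  · exact absurd (hlk ▸ hx) (hmin' _ h0 (by omega))

end FirstHit

theorem exists_firstHit [Finite N] (σ : Equiv.Perm N) {R : Set N} (hx : x ∈ R) :
    ∃ y, FirstHit σ R x y := by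
  classical
  have hex : ∃ k, 0 < k ∧ σ^[k] x ∈ R :=
    let ⟨k, hk, h⟩ := exists_pos_iterate_eq (SameCycle.refl σ x)
    ⟨k, hk, h.symm ▸ hx⟩
  obtain ⟨hpos, hmem⟩ := Nat.find_spec hex
  exact ⟨_, hmem, _, hpos, rfl, fun j hj hjk h => Nat.find_min hex hjk ⟨hj, h⟩⟩

/-- `ρ` is the permutation that `σ` induces on a subset `K` of `N`, embedded by means of `e`: it
sends each element to the first element of `K` that the orbit under `σ` meets after it. -/
structure IsFirstReturn (σ : Equiv.Perm N) (ρ : Equiv.Perm K) (e : K → N) : Prop where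
  injective : Function.Injective e
  firstHit : ∀ x, FirstHit σ (Set.range e) (e x) (e (ρ x))

theorem exists_isFirstReturn [Finite N] (σ : Equiv.Perm N) {e : K → N}
    (he : Function.Injective e) : ∃ ρ : Equiv.Perm K, IsFirstReturn σ ρ e := by
  have hex : ∀ x, ∃ y, FirstHit σ (Set.range e) (e x) (e y) := fun x =>
    let ⟨_, h⟩ := exists_firstHit σ (Set.mem_range_self (f := e) x)
    let ⟨y, hy⟩ := h.1
    ⟨y, hy ▸ h⟩
  choose r hr using hex
  have hinj : Function.Injective r := fun x y h =>
    he ((hr x).left_unique (h ▸ hr y) ⟨x, rfl⟩ ⟨y, rfl⟩)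
  have := Finite.of_injective e he
  exact ⟨Equiv.ofBijective r (Finite.injective_iff_bijective.1 hinj), he, hr⟩

theorem isFirstReturn_subtypePerm {p : N → Prop} (hp : ∀ x, p (σ x) ↔ p x) :
    IsFirstReturn σ (σ.subtypePerm hp) Subtype.val :=
  ⟨Subtype.val_injective, fun x => .of_mem ⟨σ.subtypePerm hp x, rfl⟩⟩

namespace IsFirstReturn

variable {ρ : Equiv.Perm K} {e : K → N}

theorem apply_eq (h : IsFirstReturn σ ρ e) {x y : K} (hxy : σ (e x) = e y) : ρ x = y :=
  h.injective ((h.firstHit x).right_unique (hxy ▸ .of_mem ⟨y, hxy.symm⟩))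

theorem exists_times (h : IsFirstReturn σ ρ e) (x : K) : ∃ τ : ℕ → ℕ, StrictMono τ ∧ τ 0 = 0 ∧
    (∀ n, σ^[τ n] (e x) = e (ρ^[n] x)) ∧
    ∀ m y, σ^[m] (e x) = e y → ∃ n, τ n = m ∧ ρ^[n] x = y := by
  choose k hk hkρ hmin using fun x => (h.firstHit x).2
  let τ : ℕ → ℕ := fun n => ∑ i ∈ Finset.range n, k (ρ^[i] x)
  have hsucc : ∀ n, τ (n + 1) = τ n + k (ρ^[n] x) := fun n => Finset.sum_range_succ _ _
  have hmono : StrictMono τ := strictMono_nat_of_lt_succ fun n =>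
    hsucc n ▸ Nat.lt_add_of_pos_right (hk _)
  have hτ : ∀ n, σ^[τ n] (e x) = e (ρ^[n] x) := by
    intro n
    induction n with
    | zero => rfl
    | succ n ih =>
      rw [hsucc, add_comm, Function.iterate_add_apply, ih, hkρ, Function.iterate_succ_apply']
  refine ⟨τ, hmono, rfl, hτ, fun m y hm => ?_⟩
  obtain ⟨n, hn, hn'⟩ : ∃ n, τ n ≤ m ∧ m < τ (n + 1) := by
    simpa using (iUnion_Ico_map_succ_eq_Ici (fun n => hmono.monotone n.zero_le)
      hmono.not_bddAbove_range_of_wellFoundedLT).ge (Nat.zero_le m : m ∈ Set.Ici (τ 0))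
  have heq : τ n = m := by
    by_contra hne
    refine hmin (ρ^[n] x) (m - τ n) (by omega) (by have := hsucc n; omega) ⟨y, ?_⟩
    rw [← hτ, ← Function.iterate_add_apply, Nat.sub_add_cancel hn, hm]
  exact ⟨n, heq, h.injective (by rw [← hτ, heq, hm])⟩

variable [Finite N]

theorem sameCycle_iff (h : IsFirstReturn σ ρ e) {x y : K} :
    SameCycle ρ x y ↔ SameCycle σ (e x) (e y) := by
  have := Finite.of_injective e h.injective
  obtain ⟨τ, -, -, hτ, hτ'⟩ := h.exists_times x
  constructor
  · intro hxy
    obtain ⟨n, -, rfl⟩ := exists_pos_iterate_eq hxy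
    exact hτ n ▸ sameCycle_iterate σ _ _
  · intro hxy
    obtain ⟨m, -, hm⟩ := exists_pos_iterate_eq hxy
    obtain ⟨n, -, rfl⟩ := hτ' m y hm
    exact sameCycle_iterate ρ _ _

theorem minimalPeriod_eq_of_strictMono (h : IsFirstReturn σ ρ e) {x : K} {τ : ℕ → ℕ}
    (hmono : StrictMono τ) (h0 : τ 0 = 0) (hτ : ∀ n, σ^[τ n] (e x) = e (ρ^[n] x))
    (hτ' : ∀ m y, σ^[m] (e x) = e y → ∃ n, τ n = m ∧ ρ^[n] x = y) :
    Function.minimalPeriod σ (e x) = τ (Function.minimalPeriod ρ x) := by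
  have := Finite.of_injective e h.injective
  apply le_antisymm
  · have hpos := Function.minimalPeriod_pos_of_mem_periodicPts (ρ.injective.mem_periodicPts x)
    refine Function.IsPeriodicPt.minimalPeriod_le (h0 ▸ hmono hpos) ?_
    rw [Function.IsPeriodicPt, Function.IsFixedPt, hτ, Function.iterate_minimalPeriod]
  · have hpos := Function.minimalPeriod_pos_of_mem_periodicPts (σ.injective.mem_periodicPts (e x))
    obtain ⟨n, hn, hnx⟩ := hτ' _ x Function.iterate_minimalPeriod
    rw [← hn] at hpos ⊢
    rw [← h0] at hpos
    exact hmono.monotone (Function.IsPeriodicPt.minimalPeriod_le (hmono.lt_iff_lt.1 hpos) hnx)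

theorem inCyclicOrder_iff (h : IsFirstReturn σ ρ e) {x y z w : K} :
    InCyclicOrder ρ x y z w ↔ InCyclicOrder σ (e x) (e y) (e z) (e w) := by
  obtain ⟨τ, hmono, h0, hτ, hτ'⟩ := h.exists_times x
  have hper := h.minimalPeriod_eq_of_strictMono hmono h0 hτ hτ'
  constructor
  · rintro ⟨i, j, k, hi, hij, hjk, hk, rfl, rfl, rfl⟩
    exact ⟨τ i, τ j, τ k, h0 ▸ hmono hi, hmono hij, hmono hjk, hper ▸ hmono hk, hτ _, hτ _, hτ _⟩
  · rintro ⟨i, j, k, hi, hij, hjk, hk, hy, hz, hw⟩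
    obtain ⟨i, rfl, rfl⟩ := hτ' _ _ hy
    obtain ⟨j, rfl, rfl⟩ := hτ' _ _ hz
    obtain ⟨k, rfl, rfl⟩ := hτ' _ _ hw
    rw [hper] at hk
    rw [← h0] at hi
    exact ⟨i, j, k, hmono.lt_iff_lt.1 hi, hmono.lt_iff_lt.1 hij, hmono.lt_iff_lt.1 hjk,
      hmono.lt_iff_lt.1 hk, rfl, rfl, rfl⟩

theorem alternate_iff (h : IsFirstReturn σ ρ e) {x y z w : K} :
    Alternate ρ x y z w ↔ Alternate σ (e x) (e y) (e z) (e w) :=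
  or_congr h.inCyclicOrder_iff h.inCyclicOrder_iff

end IsFirstReturn

theorem perm_eq_of_forall_ne {f g : Equiv.Perm N} (c : N) (h : ∀ x, x ≠ c → f x = g x) :
    f = g := by
  have hc : f c = g c := by
    obtain ⟨x, hx⟩ := f.surjective (g c)
    by_cases hxc : x = c
    · rw [← hx, hxc]
    · exact absurd (g.injective (h x hxc ▸ hx)) hxc
  ext x
  by_cases hxc : x = c
  · rw [hxc, hc]
  · exact h x hxc

section Swap

variable [DecidableEq K] {ρ : Equiv.Perm K} {a b : K}

theorem mul_swap_apply_left (ρ : Equiv.Perm K) (a b : K) : (ρ * Equiv.swap a b) a = ρ b := by simp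

theorem mul_swap_apply_right (ρ : Equiv.Perm K) (a b : K) : (ρ * Equiv.swap a b) b = ρ a := by simp

theorem mul_swap_apply_of_ne_of_ne (ρ : Equiv.Perm K) {x : K} (ha : x ≠ a) (hb : x ≠ b) :
    (ρ * Equiv.swap a b) x = ρ x := by
  rw [Equiv.Perm.mul_apply, Equiv.swap_apply_of_ne_of_ne ha hb]

theorem sameCycle_mul_swap_of_not_sameCycle [Finite K] (hab : ¬ SameCycle ρ a b) :
    SameCycle (ρ * Equiv.swap a b) a b := by
  by_contra hab'
  let C : Set K := {x | SameCycle ρ a x ∧ SameCycle (ρ * Equiv.swap a b) b x}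
  have hC : Set.MapsTo ρ C C := by
    rintro x ⟨hx, hx'⟩
    have hxa : x ≠ a := by
      rintro rfl
      exact hab' hx'.symm
    have hxb : x ≠ b := by
      rintro rfl
      exact hab hx
    refine ⟨Equiv.Perm.sameCycle_apply_right.2 hx, ?_⟩
    rwa [← mul_swap_apply_of_ne_of_ne ρ hxa hxb, Equiv.Perm.sameCycle_apply_right]
  have hρa : ρ a ∈ C := by
    refine ⟨Equiv.Perm.sameCycle_apply_right.2 (.refl _ _), ?_⟩
    rw [← mul_swap_apply_right ρ a b, Equiv.Perm.sameCycle_apply_right]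
  have ha : a ∈ C := mem_of_sameCycle hC (Equiv.Perm.sameCycle_apply_left.2 (.refl _ _)) hρa
  exact hab' ha.2.symm

theorem not_sameCycle_mul_swap_of_sameCycle [Finite K] (hne : a ≠ b) (hab : SameCycle ρ a b) :
    ¬ SameCycle (ρ * Equiv.swap a b) a b := by
  have hex := exists_pos_iterate_eq hab
  obtain ⟨hpos, hn⟩ := Nat.find_spec hex
  -- The arc from `a`, excluded, to the next occurrence of `b`, included, becomes a cycle.
  let C : Set K := {x | ∃ j, 0 < j ∧ j ≤ Nat.find hex ∧ ρ^[j] a = x}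
  have haC : a ∉ C := by
    rintro ⟨j, hj, hjn, hja⟩
    rcases hjn.lt_or_eq with hlt | rfl
    · refine Nat.find_min hex (Nat.sub_lt hpos hj) ⟨by omega, ?_⟩
      rw [← Nat.sub_add_cancel hjn, Function.iterate_add_apply, hja] at hn
      exact hn
    · exact hne (hja.symm.trans hn)
  have hC : Set.MapsTo (ρ * Equiv.swap a b) C C := by
    rintro x ⟨j, hj, hjn, rfl⟩
    by_cases hjb : ρ^[j] a = b
    · rw [hjb, mul_swap_apply_right]
      exact ⟨1, one_pos, hpos, rfl⟩
    · have hja : ρ^[j] a ≠ a := fun h => haC ⟨j, hj, hjn, h⟩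
      rw [mul_swap_apply_of_ne_of_ne ρ hja hjb]
      refine ⟨j + 1, j.succ_pos, ?_, Function.iterate_succ_apply' _ _ _⟩
      exact Nat.lt_of_le_of_ne hjn (by rintro rfl; exact hjb hn)
  exact fun h => haC (mem_of_sameCycle hC h.symm ⟨_, hpos, le_rfl, hn⟩)

theorem sameCycle_mul_swap [Finite K] (hab : SameCycle (ρ * Equiv.swap a b) a b) {x y : K}
    (hxy : SameCycle ρ x y) : SameCycle (ρ * Equiv.swap a b) x y := by
  refine mem_of_sameCycle (C := {y | SameCycle (ρ * Equiv.swap a b) x y}) (fun y hy => ?_) hxy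
    (.refl _ _)
  refine Set.mem_ofPred_eq ▸ (hy : SameCycle _ _ _).trans ?_
  by_cases hya : y = a
  · rw [hya, ← mul_swap_apply_right ρ a b, Equiv.Perm.sameCycle_apply_right]
    exact hab
  by_cases hyb : y = b
  · rw [hyb, ← mul_swap_apply_left ρ a b, Equiv.Perm.sameCycle_apply_right]
    exact hab.symm
  rw [← mul_swap_apply_of_ne_of_ne ρ hya hyb, Equiv.Perm.sameCycle_apply_right]

variable {v v' w w' : K}

theorem not_alternate_mul_swap (hab : ¬ SameCycle ρ a b) (hv : SameCycle ρ v v') (hva : v ≠ a)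
    (hvb : v ≠ b) (hva' : v' ≠ a) (hvb' : v' ≠ b) (hw : SameCycle ρ v w → w = a ∨ w = b)
    (hw' : SameCycle ρ v w' → w' = a ∨ w' = b) :
    ¬ Alternate (ρ * Equiv.swap a b) v v' w w' := by
  -- The cycle of `v` contains at most one of `a`, `b`, so that it has only one exit.
  let C : Set K := {x | SameCycle ρ v x ∧ x ≠ a ∧ x ≠ b}
  have hexit : ∀ x ∈ C, (ρ * Equiv.swap a b) x ∉ C →
      SameCycle ρ v (ρ x) ∧ (ρ x = a ∨ ρ x = b) := by
    rintro x ⟨hx, hxa, hxb⟩ hxC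
    rw [mul_swap_apply_of_ne_of_ne ρ hxa hxb] at hxC
    have hρx := Equiv.Perm.sameCycle_apply_right.2 hx
    exact ⟨hρx, or_iff_not_and_not.2 fun h => hxC ⟨hρx, h⟩⟩
  have hC : ∀ x ∈ C, ∀ y ∈ C, (ρ * Equiv.swap a b) x ∉ C → (ρ * Equiv.swap a b) y ∉ C →
      x = y := by
    intro x hx y hy hx' hy'
    obtain ⟨hvx, hxab⟩ := hexit x hx hx'
    obtain ⟨hvy, hyab⟩ := hexit y hy hy'
    have hxy := hvx.symm.trans hvy
    apply ρ.injective
    rcases hxab with h | h <;> rcases hyab with h' | h' <;> rw [h, h'] at hxy ⊢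
    · exact absurd hxy hab
    · exact absurd hxy.symm hab
  have hvC : v ∈ C := ⟨.refl _ _, hva, hvb⟩
  have hvC' : v' ∈ C := ⟨hv, hva', hvb'⟩
  have hwC : w ∉ C := fun h => (hw h.1).elim h.2.1 h.2.2
  have hwC' : w' ∉ C := fun h => (hw' h.1).elim h.2.1 h.2.2
  rintro (h | h)
  · exact not_inCyclicOrder_of_exit_unique hC hvC hwC hvC' hwC' h
  · exact not_inCyclicOrder_of_exit_unique hC hvC hwC' hvC' hwC h

theorem isFirstReturn_mul_swap [Finite K] (hab : ¬ SameCycle ρ a b) (v : K) :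
    IsFirstReturn (ρ * Equiv.swap a b)
      (ρ.subtypePerm (p := fun x => SameCycle ρ v x) fun _ => Equiv.Perm.sameCycle_apply_right)
      Subtype.val := by
  obtain ⟨τ, hτ⟩ := exists_isFirstReturn (ρ * Equiv.swap a b)
    (e := (Subtype.val : {x // SameCycle ρ v x} → K)) Subtype.val_injective
  convert hτ
  have happly : ∀ x : {x // SameCycle ρ v x}, x.1 ≠ a → x.1 ≠ b → ρ.subtypePerm
      (p := fun x => SameCycle ρ v x) (fun _ => Equiv.Perm.sameCycle_apply_right) x = τ x :=
    fun x hxa hxb => (hτ.apply_eq (mul_swap_apply_of_ne_of_ne ρ hxa hxb)).symm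
  by_cases ha : SameCycle ρ v a
  · have hb : ∀ x : {x // SameCycle ρ v x}, x.1 ≠ b := fun x hx => hab (ha.symm.trans (hx ▸ x.2))
    exact perm_eq_of_forall_ne ⟨a, ha⟩ fun x hx => happly x (fun h => hx (Subtype.ext h)) (hb x)
  have hne : ∀ x : {x // SameCycle ρ v x}, x.1 ≠ a := fun x hx => ha (hx ▸ x.2)
  by_cases hb : SameCycle ρ v b
  · exact perm_eq_of_forall_ne ⟨b, hb⟩ fun x hx => happly x (hne x) fun h => hx (Subtype.ext h)
  · exact Equiv.ext fun x => happly x (hne x) fun hx => hb (hx ▸ x.2)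

theorem alternate_mul_swap_iff [Finite K] (hab : ¬ SameCycle ρ a b) (hv : SameCycle ρ v v')
    (hva : v ≠ a) (hvb : v ≠ b) (hva' : v' ≠ a) (hvb' : v' ≠ b) (hw : SameCycle ρ w w') :
    Alternate (ρ * Equiv.swap a b) v v' w w' ↔ Alternate ρ v v' w w' := by
  by_cases hvw : SameCycle ρ v w
  · exact ((isFirstReturn_mul_swap hab v).alternate_iff (x := ⟨v, .refl _ _⟩) (y := ⟨v', hv⟩)
      (z := ⟨w, hvw⟩) (w := ⟨w', hvw.trans hw⟩)).symm.trans
      (isFirstReturn_subtypePerm _).alternate_iff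
  · exact iff_of_false (not_alternate_mul_swap hab hv hva hvb hva' hvb' (fun h => absurd h hvw)
      fun h => absurd (h.trans hw.symm) hvw) fun h => hvw h.sameCycle.2

end Swap

end Circuits

namespace LinkDiagram

open Equiv.Perm (SameCycle)

variable {V P : Type*} {D : LinkDiagram V P} {M : V → Bool} {x y : V × Bool ⊕ P}

theorem component_next (D : LinkDiagram V P) (x : V × Bool ⊕ P) :
    D.component (D.next x) = D.component x :=
  (Quot.sound (Linked.arc x)).symm

theorem component_crossing (D : LinkDiagram V P) (v : V) (s : Bool) :
    D.component (.inl (v, s)) = D.component (.inl (v, false)) := by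
  cases s
  · rfl
  · exact (Quot.sound (Linked.crossing v)).symm

theorem component_circuits (D : LinkDiagram V P) (M : V → Bool) (x : V × Bool ⊕ P) :
    D.component (D.circuits M x) = D.component x := by
  refine (D.component_next _).trans ?_
  rcases x with ⟨v, s⟩ | p
  · exact (D.component_crossing v _).trans (D.component_crossing v s).symm
  · rfl

theorem mem_iff_of_component_eq {X : Set (V × Bool ⊕ P)} (hnext : ∀ x, D.next x ∈ X ↔ x ∈ X)
    (hcrossing : ∀ v, .inl (v, true) ∈ X ↔ .inl (v, false) ∈ X)
    (h : D.component x = D.component y) : x ∈ X ↔ y ∈ X := by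
  have hX : ∀ x y, D.Linked x y → (x ∈ X) = (y ∈ X) := by
    intro x y hxy
    cases hxy with
    | arc => exact propext (hnext x).symm
    | crossing v => exact propext (hcrossing v).symm
  exact iff_of_eq (congrArg (Quot.lift (· ∈ X) hX) h)

theorem component_eq_of_sameCycle [Finite V] [Finite P] (h : SameCycle (D.circuits M) x y) :
    D.component y = D.component x :=
  mem_of_sameCycle (C := {z | D.component z = D.component x})
    (fun z hz => (D.component_circuits M z).trans hz) h rfl

theorem isEulerSystem_iff [Finite V] [Finite P] : D.IsEulerSystem M ↔
    ∀ v, SameCycle (D.circuits M) (.inl (v, false)) (.inl (v, true)) := by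
  refine ⟨fun h v => (h _ _).1 (D.component_crossing v true).symm, fun h x y =>
    ⟨fun hxy => ?_, fun hxy => (component_eq_of_sameCycle hxy).symm⟩⟩
  have hswitch : ∀ z, SameCycle (D.circuits M) (switch M z) z := by
    rintro (⟨v, s⟩ | p)
    · change SameCycle _ (Sum.inl (v, xor s (M v))) _
      cases s <;> cases M v
      exacts [.refl _ _, (h v).symm, .refl _ _, h v]
    · exact .refl _ _
  have hnext : ∀ z, SameCycle (D.circuits M) z (D.next z) := by
    intro z
    obtain ⟨z, rfl⟩ := (switch M).surjective z
    exact Equiv.Perm.sameCycle_apply_right.2 (hswitch z)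
  exact (mem_iff_of_component_eq (X := {z | SameCycle (D.circuits M) x z})
    (fun z => ⟨fun hz => hz.trans (hnext z).symm, fun hz => hz.trans (hnext z)⟩)
    (fun v => ⟨fun hv => hv.trans (h v).symm, fun hv => hv.trans (h v)⟩) hxy).1 (.refl _ _)

end LinkDiagram

namespace Tangle

open Equiv.Perm (SameCycle)

variable {R V W W' : Type*} {T : Tangle V} {S : Tangle W} {M : V ⊕ W → Bool}

/-- The ends of the arcs of `T`, as nodes of a diagram in which `T` lies outside a circle. -/
def outsideNode (x : V × Bool ⊕ Bool) : (V ⊕ W) × Bool ⊕ (Bool ⊕ Bool) :=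
  endEquiv.symm (.inl x)

theorem outsideNode_injective : Function.Injective (outsideNode : V × Bool ⊕ Bool →
    (V ⊕ W) × Bool ⊕ (Bool ⊕ Bool)) :=
  endEquiv.symm.injective.comp Sum.inl_injective

/-- The crossings of `T` and the crossing that closes it, as nodes of the closed diagram; the
strand of the latter that comes in at `i` stands for the point `i` of the circle. -/
def closedNode (f : Equiv.Perm Bool) : V × Bool ⊕ Bool → (V ⊕ Unit) × Bool ⊕ (Bool ⊕ Bool)
  | .inl (v, s) => .inl (.inl v, s)
  | .inr i => .inl (.inr (), f i)

theorem closedNode_injective (f : Equiv.Perm Bool) :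
    Function.Injective (closedNode f : V × Bool ⊕ Bool → _) := by
  rintro (⟨v, s⟩ | i) (⟨w, t⟩ | j) h <;> simp_all [closedNode]

theorem closedNode_inr_symm (f : Equiv.Perm Bool) (s : Bool) :
    (closedNode f (.inr (f.symm s)) : (V ⊕ Unit) × Bool ⊕ (Bool ⊕ Bool)) =
      .inl (.inr (), s) := by
  simp [closedNode]

theorem inr_notMem_range_closedNode (f : Equiv.Perm Bool) (p : Bool ⊕ Bool) :
    (.inr p : (V ⊕ Unit) × Bool ⊕ (Bool ⊕ Bool)) ∉ Set.range (closedNode f) := by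
  rintro ⟨⟨v, s⟩ | i, h⟩ <;> simp [closedNode] at h

/-- How the circuits run outside the circle when, inside it, the entry `i` is connected to the exit
`ρ i`: from the end of an arc to the end of the next one. -/
def returnPerm (T : Tangle V) (m : V → Bool) (ρ : Equiv.Perm Bool) :
    Equiv.Perm (V × Bool ⊕ Bool) :=
  ((LinkDiagram.switch m).trans (Equiv.sumCongr (Equiv.refl _) ρ)).trans T.arc

theorem returnPerm_mul_swap (T : Tangle V) (m : V → Bool) (ρ : Equiv.Perm Bool) :
    T.returnPerm m (ρ * Equiv.swap false true) =
      T.returnPerm m ρ * Equiv.swap (.inr false) (.inr true) := by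
  ext1 x
  rcases x with x | _ | _
  · rw [mul_swap_apply_of_ne_of_ne _ (by simp) (by simp)]
    rfl
  · rw [mul_swap_apply_left]
    rfl
  · rw [mul_swap_apply_right]
    rfl

theorem perm_bool_eq_or : ∀ ρ τ : Equiv.Perm Bool, τ = ρ ∨ τ = ρ * Equiv.swap false true := by
  decide

theorem exists_isFirstReturn_returnPerm [Finite V] [Finite W] (T : Tangle V) (S : Tangle W)
    (M : V ⊕ W → Bool) : ∃ ρ, IsFirstReturn ((T.glue S).circuits M)
      (T.returnPerm (M ∘ Sum.inl) ρ) outsideNode := by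
  obtain ⟨τ, hτ⟩ := exists_isFirstReturn ((T.glue S).circuits M)
    (outsideNode_injective (V := V) (W := W))
  set τ₁ := T.returnPerm (M ∘ Sum.inl) 1
  have hinl : ∀ x : V × Bool, τ (.inl x) = τ₁ (.inl x) := fun x => hτ.apply_eq rfl
  have hfix : ∀ x : V × Bool, (τ₁⁻¹ * τ) (.inl x) = .inl x := fun x => by simp [hinl]
  obtain ⟨⟨_, ρ⟩, hρ⟩ := Equiv.Perm.mem_sumCongrHom_range_of_perm_mapsTo_inl (σ := τ₁⁻¹ * τ) (by
    rintro _ ⟨x, rfl⟩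
    exact ⟨x, (hfix x).symm⟩)
  suffices T.returnPerm (M ∘ Sum.inl) ρ = τ from ⟨ρ, this ▸ hτ⟩
  ext1 x
  rcases x with x | i
  · exact (hinl x).symm
  · have hi : (τ₁⁻¹ * τ) (.inr i) = .inr (ρ i) := by
      rw [← hρ]
      rfl
    exact ((Equiv.Perm.inv_eq_iff_eq (f := τ₁)).1 hi).symm

theorem isFirstReturn_closedNode (T : Tangle V) (M : V ⊕ W → Bool) (isNegative : Prop)
    (f g : Equiv.Perm Bool) : IsFirstReturn ((T.closure isNegative f g).circuits (closedMarks M))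
      (T.returnPerm (M ∘ Sum.inl) (f.trans g)) (closedNode f) := by
  refine ⟨closedNode_injective f, ?_⟩
  set c := (T.closure isNegative f g).circuits (closedMarks M)
  have houtside : ∀ x y, c x = outsideNode y →
      FirstHit c (Set.range (closedNode f)) x (closedNode f y) := by
    rintro x (y | i) hx
    · change c x = closedNode f (.inl y) at hx
      exact hx ▸ .of_mem ⟨_, hx.symm⟩
    · change c x = .inr (.inl i) at hx
      exact .of_notMem (hx ▸ inr_notMem_range_closedNode f _) (hx ▸ .of_mem ⟨.inr i, rfl⟩)
  rintro (⟨v, s⟩ | i)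
  · exact houtside _ _ rfl
  · have hexit : c (closedNode f (.inr i)) = .inr (.inr (g (f i))) := by
      change (T.closure isNegative f g).next (.inl (.inr (), xor (f i) false)) = _
      rw [Bool.xor_false]
      rfl
    exact .of_notMem (hexit ▸ inr_notMem_range_closedNode f _) (hexit ▸ houtside _ _ rfl)

theorem sameCycle_inr_comm {ρ : Equiv.Perm (V × Bool ⊕ Bool)} (f : Equiv.Perm Bool) :
    SameCycle ρ (.inr (f false)) (.inr (f true)) ↔ SameCycle ρ (.inr false) (.inr true) := by
  rcases perm_bool_eq_or 1 f with rfl | rfl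
  · exact Iff.rfl
  · exact Equiv.Perm.sameCycle_comm

theorem alternate_inr_comm {ρ : Equiv.Perm (V × Bool ⊕ Bool)} (f : Equiv.Perm Bool)
    {y y' : V × Bool ⊕ Bool} : Alternate ρ (.inr (f false)) (.inr (f true)) y y' ↔
      Alternate ρ (.inr false) (.inr true) y y' := by
  rcases perm_bool_eq_or 1 f with rfl | rfl
  · exact Iff.rfl
  · exact ⟨Alternate.swap_left, Alternate.swap_left⟩

section Circuits

variable [Finite V] {isNegative : Prop} {f g : Equiv.Perm Bool}

theorem isCompatible_iff : T.IsCompatible M isNegative f g ↔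
    (∀ v, SameCycle (T.returnPerm (M ∘ Sum.inl) (f.trans g)) (.inl (v, false)) (.inl (v, true))) ∧
      SameCycle (T.returnPerm (M ∘ Sum.inl) (f.trans g)) (.inr false) (.inr true) := by
  have h := T.isFirstReturn_closedNode M isNegative f g
  rw [IsCompatible, LinkDiagram.isEulerSystem_iff, Sum.forall, ← sameCycle_inr_comm f.symm,
    h.sameCycle_iff, closedNode_inr_symm, closedNode_inr_symm]
  simp only [h.sameCycle_iff]
  exact and_congr Iff.rfl ⟨fun h => h (), fun h _ => h⟩

theorem returnPerm_eq_or_of_isCompatible (hf : T.IsCompatible M isNegative f g)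
    (ρ : Equiv.Perm Bool) :
    T.returnPerm (M ∘ Sum.inl) (f.trans g) = T.returnPerm (M ∘ Sum.inl) ρ ∨
      T.returnPerm (M ∘ Sum.inl) (f.trans g) =
        T.returnPerm (M ∘ Sum.inl) ρ * Equiv.swap (.inr false) (.inr true) ∧
      ¬ SameCycle (T.returnPerm (M ∘ Sum.inl) ρ) (.inr false) (.inr true) := by
  rcases perm_bool_eq_or ρ (f.trans g) with h | h
  · exact .inl (congrArg _ h)
  · have hswap := h ▸ returnPerm_mul_swap T (M ∘ Sum.inl) ρ
    refine .inr ⟨hswap, fun hρ => ?_⟩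
    refine not_sameCycle_mul_swap_of_sameCycle (by simp) hρ ?_
    rw [← hswap]
    exact (isCompatible_iff.1 hf).2

variable [Finite W]
  (hM : ∀ v : V, SameCycle ((T.glue S).circuits M) (.inl (.inl v, false)) (.inl (.inl v, true)))

include hM

theorem exists_isCompatible (isNegative : Prop) :
    ∃ f g : Equiv.Perm Bool, T.IsCompatible M isNegative f g := by
  obtain ⟨ρ, hρ⟩ := exists_isFirstReturn_returnPerm T S M
  have hv : ∀ v, SameCycle (T.returnPerm (M ∘ Sum.inl) ρ) (.inl (v, false)) (.inl (v, true)) :=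
    fun v => hρ.sameCycle_iff.2 (hM v)
  by_cases hab : SameCycle (T.returnPerm (M ∘ Sum.inl) ρ) (.inr false) (.inr true)
  · exact ⟨1, ρ, isCompatible_iff.2 ⟨hv, hab⟩⟩
  · have hab' := sameCycle_mul_swap_of_not_sameCycle hab
    refine ⟨1, ρ * Equiv.swap false true, isCompatible_iff.2 ?_⟩
    change (∀ v, SameCycle (T.returnPerm _ (ρ * Equiv.swap false true)) _ _) ∧
      SameCycle (T.returnPerm _ (ρ * Equiv.swap false true)) _ _
    rw [returnPerm_mul_swap]
    exact ⟨fun v => sameCycle_mul_swap hab' (hv v), hab'⟩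

theorem interlaced_closure_iff (hf : T.IsCompatible M isNegative f g) (v w : V) :
    (T.closure isNegative f g).Interlaced (closedMarks M) (.inl v) (.inl w) ↔
      (T.glue S).Interlaced M (.inl v) (.inl w) := by
  obtain ⟨ρ, hρ⟩ := exists_isFirstReturn_returnPerm T S M
  refine ((T.isFirstReturn_closedNode M isNegative f g).alternate_iff (x := .inl (v, false))
    (y := .inl (v, true)) (z := .inl (w, false)) (w := .inl (w, true))).symm.trans
    (Iff.trans ?_ (hρ.alternate_iff (x := .inl (v, false)) (y := .inl (v, true))
      (z := .inl (w, false)) (w := .inl (w, true))))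
  rcases returnPerm_eq_or_of_isCompatible hf ρ with h | ⟨h, hab⟩
  · rw [h]
  · rw [h]
    exact alternate_mul_swap_iff hab (hρ.sameCycle_iff.2 (hM v)) (by simp) (by simp) (by simp)
      (by simp) (hρ.sameCycle_iff.2 (hM w))

theorem interlaced_closure_inr_iff (hf : T.IsCompatible M isNegative f g) (v : V) :
    (T.closure isNegative f g).Interlaced (closedMarks M) (.inr ()) (.inl v) ↔
      Alternate ((T.glue S).circuits M) (.inr (.inl false)) (.inr (.inl true))
        (.inl (.inl v, false)) (.inl (.inl v, true)) := by
  obtain ⟨ρ, hρ⟩ := exists_isFirstReturn_returnPerm T S M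
  have hclosed := (T.isFirstReturn_closedNode M isNegative f g).alternate_iff
    (x := .inr (f.symm false)) (y := .inr (f.symm true)) (z := .inl (v, false))
    (w := .inl (v, true))
  rw [closedNode_inr_symm, closedNode_inr_symm, alternate_inr_comm f.symm] at hclosed
  refine hclosed.symm.trans (Iff.trans ?_ (hρ.alternate_iff (x := .inr false) (y := .inr true)
    (z := .inl (v, false)) (w := .inl (v, true))))
  rcases returnPerm_eq_or_of_isCompatible hf ρ with h | ⟨h, hab⟩
  · rw [h]
  · have hv : SameCycle (T.returnPerm (M ∘ Sum.inl) ρ) (.inl (v, false)) (.inl (v, true)) :=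
      hρ.sameCycle_iff.2 (hM v)
    rw [h]
    refine iff_of_false (fun halt => ?_) fun halt => hab halt.sameCycle.1
    exact not_alternate_mul_swap hab hv (by simp) (by simp) (by simp) (by simp)
      (fun _ => .inl rfl) (fun _ => .inr rfl) halt.symm

end Circuits

section Components

/-- The components of the universe that lie outside the circle. -/
def outsideComponents (T : Tangle V) (S : Tangle W) : Set (T.glue S).Component :=
  {c | (∃ v : V, (T.glue S).component (.inl (.inl v, false)) = c) ∧
    ∀ p, (T.glue S).component (.inr p) ≠ c}

theorem exists_outside_iff_of_component_eq (T : Tangle V) (S : Tangle W) (S' : Tangle W')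
    {c : (T.glue S).Component} (hc : ∀ p, (T.glue S).component (.inr p) ≠ c)
    {z z' : (V ⊕ W') × Bool ⊕ (Bool ⊕ Bool)}
    (h : (T.glue S').component z = (T.glue S').component z') :
    (∃ v s, z = .inl (.inl v, s) ∧ (T.glue S).component (.inl (.inl v, s)) = c) ↔
      ∃ v s, z' = .inl (.inl v, s) ∧ (T.glue S).component (.inl (.inl v, s)) = c := by
  let X : Set ((V ⊕ W') × Bool ⊕ (Bool ⊕ Bool)) :=
    {z | ∃ v s, z = .inl (.inl v, s) ∧ (T.glue S).component (.inl (.inl v, s)) = c}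
  have hinl : ∀ v s, .inl (.inl v, s) ∈ X ↔ (T.glue S).component (.inl (.inl v, s)) = c := by
    refine fun v s => ⟨?_, fun h => ⟨v, s, rfl, h⟩⟩
    rintro ⟨_, _, ⟨⟩, h⟩
    exact h
  have hpoint : ∀ p, .inr p ∉ X := by
    rintro p ⟨_, _, ⟨⟩, -⟩
  have houtside : ∀ y, outsideNode y ∈ X ↔ (T.glue S).component (outsideNode y) = c := by
    rintro (⟨v, s⟩ | i)
    · exact hinl v s
    · exact iff_of_false (hpoint _) (hc _)
  have hinside : ∀ y, endEquiv.symm (.inr y) ∉ X := by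
    rintro (⟨w, s⟩ | o)
    · rintro ⟨_, _, ⟨⟩, -⟩
    · exact hpoint _
  refine LinkDiagram.mem_iff_of_component_eq (X := X) ?_ ?_ h
  · rintro (⟨v | w, s⟩ | i | o)
    · exact (houtside _).trans ((hinl v s).trans
        (iff_of_eq (congrArg (· = c) ((T.glue S).component_next (.inl (.inl v, s))).symm))).symm
    · exact iff_of_false (hinside _) (hinside (.inl (w, s)))
    · exact iff_of_false (hinside _) (hpoint _)
    · refine iff_of_false (fun hmem => hc (.inr o) ?_) (hpoint _)
      exact ((T.glue S).component_next (.inr (.inr o))).symm.trans ((houtside _).1 hmem)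
  · rintro (v | w)
    · rw [hinl, hinl, LinkDiagram.component_crossing]
    · exact iff_of_false (hinside (.inl (w, true))) (hinside (.inl (w, false)))

theorem outside_glue_of_outside_glue (T : Tangle V) (S : Tangle W) (S' : Tangle W') {v : V}
    (hv : ∀ p, (T.glue S).component (.inr p) ≠ (T.glue S).component (.inl (.inl v, false))) :
    (∀ p, (T.glue S').component (.inr p) ≠ (T.glue S').component (.inl (.inl v, false))) ∧
      ∀ w, (T.glue S').component (.inl (.inl w, false)) =
          (T.glue S').component (.inl (.inl v, false)) →
        (T.glue S).component (.inl (.inl w, false)) =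
          (T.glue S).component (.inl (.inl v, false)) := by
  have key : ∀ {z}, (T.glue S').component z = (T.glue S').component (.inl (.inl v, false)) →
      ∃ w s, z = .inl (.inl w, s) ∧ (T.glue S).component (.inl (.inl w, s)) =
        (T.glue S).component (.inl (.inl v, false)) :=
    fun h => (exists_outside_iff_of_component_eq T S S' hv h).2 ⟨v, false, rfl, rfl⟩
  refine ⟨fun p hp => ?_, fun w hw => ?_⟩
  · obtain ⟨_, _, ⟨⟩, -⟩ := key hp
  · obtain ⟨_, _, ⟨⟩, hc⟩ := key hw
    exact hc

/-- The crossings outside the circle that lie in a given component of the universe. -/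
def outsideCrossings (T : Tangle V) (S : Tangle W) (c : (T.glue S).Component) : Set V :=
  {v | (T.glue S).component (.inl (.inl v, false)) = c}

theorem injOn_outsideCrossings (T : Tangle V) (S : Tangle W) :
    Set.InjOn (T.outsideCrossings S) (T.outsideComponents S) := by
  rintro _ ⟨⟨v, rfl⟩, -⟩ c' - h
  exact (Set.ext_iff.1 h v).1 rfl

theorem image_outsideCrossings_subset (T : Tangle V) (S : Tangle W) (S' : Tangle W') :
    T.outsideCrossings S '' T.outsideComponents S ⊆
      T.outsideCrossings S' '' T.outsideComponents S' := by
  rintro _ ⟨_, ⟨⟨v, rfl⟩, hv⟩, rfl⟩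
  obtain ⟨hv', hSS'⟩ := outside_glue_of_outside_glue T S S' hv
  exact ⟨_, ⟨⟨v, rfl⟩, hv'⟩, Set.ext fun w =>
    ⟨hSS' w, (outside_glue_of_outside_glue T S' S hv').2 w⟩⟩

theorem ncard_outsideComponents_eq (T : Tangle V) (S : Tangle W) (S' : Tangle W') :
    (T.outsideComponents S).ncard = (T.outsideComponents S').ncard := by
  rw [← (injOn_outsideCrossings T S).ncard_image, ← (injOn_outsideCrossings T S').ncard_image,
    (image_outsideCrossings_subset T S S').antisymm (image_outsideCrossings_subset T S' S)]

variable {isNegative : Prop} {f g : Equiv.Perm Bool}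

theorem component_closure_inr (p : Bool ⊕ Bool) :
    (T.closure isNegative f g).component (.inr p) =
      (T.closure isNegative f g).component (.inl (.inr (), false)) := by
  set D := T.closure isNegative f g
  rcases p with i | o
  · have hnext : D.next (.inr (.inl i)) = .inl (.inr (), f i) := rfl
    rw [← D.component_next, hnext, D.component_crossing]
  · have hnext : D.next (.inl (.inr (), g.symm o)) = .inr (.inr o) := by
      change Sum.inr (Sum.inr (g (g.symm o))) = _
      rw [g.apply_symm_apply]
    rw [← hnext, D.component_next, D.component_crossing]

theorem outsideComponents_oneCrossing :
    T.outsideComponents (oneCrossing isNegative f g) =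
      {(T.closure isNegative f g).component (.inl (.inr (), false))}ᶜ := by
  ext c
  constructor
  · rintro ⟨-, hc⟩ rfl
    exact hc (.inl false) (component_closure_inr _)
  · intro hc
    refine ⟨?_, fun p hp => hc (hp.symm.trans (component_closure_inr p))⟩
    induction c using Quot.ind with
    | mk x =>
      rcases x with ⟨v | ⟨⟩, s⟩ | p
      · exact ⟨v, ((T.closure isNegative f g).component_crossing (.inl v) s).symm⟩
      · exact absurd ((T.closure isNegative f g).component_crossing (.inr ()) s) hc
      · exact absurd (component_closure_inr p) hc

theorem natCard_component_closure [Finite V] (T : Tangle V) (S : Tangle W) (isNegative : Prop)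
    (f g : Equiv.Perm Bool) : Nat.card (T.closure isNegative f g).Component =
      (T.outsideComponents S).ncard + 1 := by
  have : Finite (T.closure isNegative f g).Component := inferInstanceAs (Finite (Quot _))
  rw [T.ncard_outsideComponents_eq S (oneCrossing isNegative f g), outsideComponents_oneCrossing,
    add_comm, ← Set.ncard_add_ncard_compl {_}, Set.ncard_singleton]
  rfl

end Components

end Tangle

namespace Tangle

variable {R V W : Type*} {T : Tangle V} {S : Tangle W} {M : V ⊕ W → Bool}

theorem bracket_closedGraph [CommRing R] [Fintype V] [Finite W] (A B d : R) (α β : V → R)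
    (hM : ∀ v : V, ((T.glue S).circuits M).SameCycle (.inl (.inl v, false)) (.inl (.inl v, true)))
    {isNegative : Prop} {f g : Equiv.Perm Bool} (hf : T.IsCompatible M isNegative f g) :
    (T.closedGraph M isNegative f g A B α β).bracket d =
      (((T.outsideGraph S M A B α β).delete none).join
        (fun v => (T.outsideGraph S M A B α β).graph.Adj v none)
        (MarkedGraph.single isNegative False A B) fun _ => True).bracket d := by
  have hnew : ∀ v, (T.closedGraph M isNegative f g A B α β).graph.Adj (.inl v) (.inr ()) ↔
      (T.outsideGraph S M A B α β).graph.Adj (some v) none := by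
    intro v
    have hinr := interlaced_closure_inr_iff hM hf v
    have hinl : (T.closure isNegative f g).Interlaced (closedMarks M) (.inl v) (.inr ()) ↔ _ :=
      alternate_comm.trans hinr
    simp [closedGraph, LinkDiagram.interlacementGraph, outsideGraph, hinr, hinl]
  let e : V ≃ {x : Option V // x ≠ none} :=
    (Equiv.optionIsSomeEquiv V).symm.trans
      (Equiv.subtypeEquivRight fun _ => Option.isSome_iff_ne_none)
  refine MarkedGraph.bracket_congr d (e.sumCongr (Equiv.refl Unit)) ?_ ?_ ?_ ?_ ?_ ?_
  · rintro (v | ⟨⟩) (w | ⟨⟩)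
    · have hvw := interlaced_closure_iff hM hf v w
      have hwv := interlaced_closure_iff hM hf w v
      change (T.outsideGraph S M A B α β).graph.Adj (some v) (some w) ↔ _
      simp [closedGraph, LinkDiagram.interlacementGraph, outsideGraph, hvw, hwv]
    · rw [hnew]
      exact and_iff_left trivial
    · rw [(T.closedGraph M isNegative f g A B α β).graph.adj_comm, hnew]
      exact and_iff_left trivial
    · exact iff_of_false (SimpleGraph.irrefl _) (SimpleGraph.irrefl _)
  · rintro (v | ⟨⟩)
    · exact ⟨fun ⟨w, hw, h⟩ => Option.some.inj hw ▸ h, fun h => ⟨v, rfl, h⟩⟩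
    · exact Iff.rfl
  · rintro (v | ⟨⟩)
    · exact ⟨fun ⟨w, hw, h⟩ => Option.some.inj hw ▸ h, fun h => ⟨v, rfl, h⟩⟩
    · exact iff_of_false not_false Bool.false_ne_true
  · rintro (v | ⟨⟩) <;> rfl
  · rintro (v | ⟨⟩) <;> rfl
  · change T.freeLoops + (T.outsideComponents S).ncard + 0 =
      Nat.card (T.closure isNegative f g).Component + (T.freeLoops + 0) - 1
    rw [natCard_component_closure T S]
    omega

end Tangle

theorem eq_add_divp_of_mul_eq {R : Type*} [CommRing R] (u : Rˣ) {a b c : R}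
    (h : u * a = u * b + c) : a = b + c /ₚ u := by
  rw [eq_comm, ← eq_sub_iff_add_eq', divp_eq_iff_mul_eq]
  linear_combination h

theorem corollary9_general {R V W : Type*} [CommRing R] [Fintype V] [Finite W]
    (A B d : R) (α β : V → R) (T : Tangle V) (S : Tangle W) (M : V ⊕ W → Bool)
    (hM : ∀ v : V, ((T.glue S).circuits M).SameCycle (.inl (.inl v, false)) (.inl (.inl v, true))) :
    (∃ x y z : R, (T.outsideGraph S M A B α β).IsJoinWeights A B d none x y z) ∧
    (∀ isNegative : Prop, ∃ f g : Equiv.Perm Bool, T.IsCompatible M isNegative f g) ∧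
    ∀ x y z : R, (T.outsideGraph S M A B α β).IsJoinWeights A B d none x y z →
      ∀ f₁ g₁ f₂ g₂ : Equiv.Perm Bool,
        T.IsCompatible M False f₁ g₁ → T.IsCompatible M True f₂ g₂ →
        ∀ F₀ F₁ F₂ : R,
          F₀ = ((T.outsideGraph S M A B α β).delete none).bracket d →
          F₁ = (T.closedGraph M False f₁ g₁ A B α β).bracket d →
          F₂ = (T.closedGraph M True f₂ g₂ A B α β).bracket d →
          ((A + B) * ((2 - d - d ^ 2) * x) = (A + B) * (-(d + 1) * F₀) + (F₁ + F₂) ∧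
            (A ^ 2 - B ^ 2) * ((2 - d - d ^ 2) * y) =
              (A ^ 2 - B ^ 2) * F₀ + ((A + B + B * d) * F₁ - (A + A * d + B) * F₂) ∧
            (A ^ 2 - B ^ 2) * ((2 - d - d ^ 2) * z) =
              (A ^ 2 - B ^ 2) * F₀ + ((A + B + B * d) * F₂ - (A + A * d + B) * F₁)) ∧
          (∀ u : Rˣ, (u : R) = A + B →
            (2 - d - d ^ 2) * x = -(d + 1) * F₀ + (F₁ + F₂) /ₚ u) ∧
          (∀ u : Rˣ, (u : R) = A ^ 2 - B ^ 2 →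
            (2 - d - d ^ 2) * y =
                F₀ + ((A + B + B * d) * F₁ - (A + A * d + B) * F₂) /ₚ u ∧
              (2 - d - d ^ 2) * z =
                F₀ + ((A + B + B * d) * F₂ - (A + A * d + B) * F₁) /ₚ u) := by
  refine ⟨MarkedGraph.exists_isJoinWeights A B d _ none, Tangle.exists_isCompatible hM, ?_⟩
  intro x y z h f₁ g₁ f₂ g₂ h₁ h₂ F₀ F₁ F₂ hF₀ hF₁ hF₂
  rw [h.bracket_delete] at hF₀
  rw [Tangle.bracket_closedGraph A B d α β hM h₁, h.bracket_join_single_unlooped] at hF₁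
  rw [Tangle.bracket_closedGraph A B d α β hM h₂, h.bracket_join_single_looped] at hF₂
  have hx : (A + B) * ((2 - d - d ^ 2) * x) = (A + B) * (-(d + 1) * F₀) + (F₁ + F₂) := by
    rw [hF₀, hF₁, hF₂]
    ring
  have hy : (A ^ 2 - B ^ 2) * ((2 - d - d ^ 2) * y) =
      (A ^ 2 - B ^ 2) * F₀ + ((A + B + B * d) * F₁ - (A + A * d + B) * F₂) := by
    rw [hF₀, hF₁, hF₂]
    ring
  have hz : (A ^ 2 - B ^ 2) * ((2 - d - d ^ 2) * z) =
      (A ^ 2 - B ^ 2) * F₀ + ((A + B + B * d) * F₂ - (A + A * d + B) * F₁) := by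
    rw [hF₀, hF₁, hF₂]
    ring
  exact ⟨⟨hx, hy, hz⟩, fun u hu => eq_add_divp_of_mul_eq u (hu ▸ hx),
    fun u hu => ⟨eq_add_divp_of_mul_eq u (hu ▸ hy), eq_add_divp_of_mul_eq u (hu ▸ hz)⟩⟩

theorem corollary9 {R V W : Type*} [CommRing R] [Fintype V] [Fintype W]
    (A B d : R) (α β : V → R) (T : Tangle V) (S : Tangle W) (M : V ⊕ W → Bool)
    (hM : (T.glue S).IsEulerSystem M) :
    (∃ x y z : R, (T.outsideGraph S M A B α β).IsJoinWeights A B d none x y z) ∧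
    (∀ isNegative : Prop, ∃ f g : Equiv.Perm Bool, T.IsCompatible M isNegative f g) ∧
    ∀ x y z : R, (T.outsideGraph S M A B α β).IsJoinWeights A B d none x y z →
      ∀ f₁ g₁ f₂ g₂ : Equiv.Perm Bool,
        T.IsCompatible M False f₁ g₁ → T.IsCompatible M True f₂ g₂ →
        ∀ F₀ F₁ F₂ : R,
          F₀ = ((T.outsideGraph S M A B α β).delete none).bracket d →
          F₁ = (T.closedGraph M False f₁ g₁ A B α β).bracket d →
          F₂ = (T.closedGraph M True f₂ g₂ A B α β).bracket d →
          ((A + B) * ((2 - d - d ^ 2) * x) = (A + B) * (-(d + 1) * F₀) + (F₁ + F₂) ∧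
            (A ^ 2 - B ^ 2) * ((2 - d - d ^ 2) * y) =
              (A ^ 2 - B ^ 2) * F₀ + ((A + B + B * d) * F₁ - (A + A * d + B) * F₂) ∧
            (A ^ 2 - B ^ 2) * ((2 - d - d ^ 2) * z) =
              (A ^ 2 - B ^ 2) * F₀ + ((A + B + B * d) * F₂ - (A + A * d + B) * F₁)) ∧
          (∀ u : Rˣ, (u : R) = A + B →
            (2 - d - d ^ 2) * x = -(d + 1) * F₀ + (F₁ + F₂) /ₚ u) ∧
          (∀ u : Rˣ, (u : R) = A ^ 2 - B ^ 2 →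
            (2 - d - d ^ 2) * y =
                F₀ + ((A + B + B * d) * F₁ - (A + A * d + B) * F₂) /ₚ u ∧
              (2 - d - d ^ 2) * z =
                F₀ + ((A + B + B * d) * F₂ - (A + A * d + B) * F₁) /ₚ u) :=
  corollary9_general A B d α β T S M fun v =>
    (hM _ _).1 ((T.glue S).component_crossing (.inl v) true).symm
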